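/- Let $I=[0,1]$, let $\lambda_n>0$ and $\delta_n>0$ be sequences with $\lambda_n\to0$, $\delta_n\to0$ and $\lambda_n/\sqrt{\delta_n}\to0$, and let $k_n\in\mathbb N$ with $k_n\delta_n^{1/4}\to0$. For each $n$ let $Q_{k_n}=\{q_1^n,\dots,q_{k_n}^n\}\subset\mathbb S^2$ consist of $k_n$ distinct points, put $M_{k_n}=\bigcup_{l=1}^{k_n}\{v\in\mathbb S^2: v\cdot q^n_l=0\}$, and assume that the sets $Q_{k_n}$ converge in the sense of Kuratowski to a closed set $\overline Q$, i.e. every cluster point of a sequence $x_n\in Q_{k_n}$ lies in $\overline Q$ and every point of $\overline Q$ is the limit of such a sequence. Put $N_n=\lfloor 1/\lambda_n\rfloor$. (Since $\lambda_n\to0$, the finitely many $n$ with $\lambda_n>1$ play no role in what follows.) Let $C_n(I;M_{k_n})$ be the set of all $u:\{0,1,\dots,N_n\}\to M_{k_n}$ with $u^1\cdot u^0=u^{N_n}\cdot u^{N_n-1}$. For such $u$ let $$H_n^{sl}(u)=\frac12\sum_{i=0}^{N_n-2}\lambda_n\,\bigl|u^i-2(1-\delta_n)u^{i+1}+u^{i+2}\bigr|^2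 ,$$ and let the chirality $T_n(u)\in L^1(I;\mathbb R^3)$ be the piecewise constant function equal to $z^i$ on $I\cap\lambda_n(i+[0,1))$, where $z^i=\dfrac{u^i\times u^{i+1}}{\sqrt{2\delta_n}}$ for $0\le i\le N_n-1$ and $z^{N_n}=z^{N_n-1}$. For $z\in L^1(I;\mathbb R^3)$ set $$H_n^{sl,k_n}(z)=\inf\{H_n^{sl}(u): u\in C_n(I;M_{k_n}),\ T_n(u)=z\}\in[0,+\infty],\qquad \inf\emptyset=+\infty .$$ Let $u_n\in C_n(I;M_{k_n})$ and $z_n=T_n(u_n)$ satisfy, for some constant $C>0$ and all $n$, $$H_n^{sl,k_n}(z_n)\le C\lambda_n\delta_n^{3/2}.$$ Then there are a subsequence of $(z_n)$ and a function $z$ on $I$ such that the subsequence converges to $z$ strongly in $L^1(I;\mathbb R^3)$, and $z$ is piecewise constant with finitely many jumps and values in $\overline Q\cup(-\overline Q)$: there are $0=t_0<t_1<\dots<t_m=1$ such that $z$ is a.e. equal to a constant element of $\overline Q\cup(-\overline Q)$ on each $(t_{i},t_{i+1})$. In particular $z$ takes its values in $\overline Q$ whenever $\overline Q=-\overline Q$.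 -/

import Mathlib

open MeasureTheory Filter Topology Set
open scoped ENNReal Pointwise

namespace HelicalXY

/-- Three-dimensional Euclidean space. -/
abbrev E3 : Type := EuclideanSpace ℝ (Fin 3)

/-- The unit interval `I = [0,1]` with Lebesgue measure. -/
noncomputable abbrev volI : Measure ℝ := volume.restrict (Icc (0 : ℝ) 1)

/-- The Banach space `L¹(I; ℝ³)`. -/
abbrev L1I : Type := Lp E3 1 volI

/-- The vector product on `E3`. -/
noncomputable def cross (a b : E3) : E3 :=
  WithLp.toLp 2 (crossProduct (WithLp.ofLp a) (WithLp.ofLp b))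

/-- The lattice points of the unit interval: the integers `i` with `lam * i ∈ [0,1]`
(see `mem_latticePoints`). -/
noncomputable def latticePoints (lam : ℝ) : Finset ℤ := Finset.Icc 0 ⌊1 / lam⌋

theorem mem_latticePoints {lam : ℝ} (h : 0 < lam) (i : ℤ) :
    i ∈ latticePoints lam ↔ lam * (i : ℝ) ∈ Icc (0 : ℝ) 1 := by
  rw [latticePoints, Finset.mem_Icc, Int.le_floor, le_div_iff₀ h, mem_Icc, mul_comm (i : ℝ) lam,
    mul_nonneg_iff_of_pos_left h, Int.cast_nonneg_iff]

/-- The indices `i` such that both `i` and `i + 2` are lattice points. -/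
noncomputable def interiorPoints (lam : ℝ) : Finset ℤ :=
  (latticePoints lam).filter (fun i => i + 2 ∈ latticePoints lam)

/-- Given a set `Q` of unit vectors: the union of the great circles `𝕊² ∩ q^⊥`, `q ∈ Q`. -/
def circles (Q : Set E3) : Set E3 :=
  {v | ‖v‖ = 1 ∧ ∃ q ∈ Q, inner ℝ q v = 0}

/-- Spin configurations with values in `M` on the lattice points of `[0,1]`, with the boundary
condition `(u¹, u⁰) = (u^N, u^(N-1))`, `N = ⌊1/lam⌋`. A configuration is represented by a function
on `ℤ`, of which only the values at the lattice points matter. -/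
def IsConfig (lam : ℝ) (M : Set E3) (u : ℤ → E3) : Prop :=
  (∀ i ∈ latticePoints lam, u i ∈ M) ∧
    inner ℝ (u 1) (u 0) = inner ℝ (u ⌊1 / lam⌋) (u (⌊1 / lam⌋ - 1))

/-- The one-dimensional renormalized energy
`(1/2) ∑ lam |u^i - 2 (1 - δ) u^(i+1) + u^(i+2)|²`. -/
noncomputable def slicedEnergy (lam δ : ℝ) (u : ℤ → E3) : ℝ :=
  1 / 2 * ∑ i ∈ interiorPoints lam,
    lam * ‖u i - (2 * (1 - δ)) • u (i + 1) + u (i + 2)‖ ^ 2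

/-- The rescaled angular velocity `z^i = (u^i × u^(i+1)) / √(2δ)` for `i < N = ⌊1/lam⌋`,
with `z^N := z^(N-1)`. -/
noncomputable def chiralityAt (lam δ : ℝ) (u : ℤ → E3) (i : ℤ) : E3 :=
  let j := min i (⌊1 / lam⌋ - 1)
  (Real.sqrt (2 * δ))⁻¹ • cross (u j) (u (j + 1))

/-- Piecewise constant interpolation: the value is `v i` on `lam * (i + [0,1))`. -/
noncomputable def interpolation (lam : ℝ) (v : ℤ → E3) (x : ℝ) : E3 := v ⌊x / lam⌋

theorem memLp_interpolation (lam : ℝ) (v : ℤ → E3) : MemLp (interpolation lam v) 1 volI := by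
  have hm : Measurable (interpolation lam v) :=
    (measurable_from_top (f := v)).comp (Int.measurable_floor.comp (measurable_id.div_const lam))
  refine MemLp.of_bound hm.aestronglyMeasurable
    (∑ i ∈ Finset.Icc ⌊-|1 / lam|⌋ ⌊|1 / lam|⌋, ‖v i‖) ?_
  refine (ae_restrict_iff' measurableSet_Icc).2 (Eventually.of_forall fun x hx => ?_)
  have h1 : |x / lam| ≤ |1 / lam| := by
    rw [abs_div, abs_div, abs_of_nonneg hx.1, abs_one]
    exact div_le_div_of_nonneg_right hx.2 (abs_nonneg _)
  have h2 := abs_le.1 h1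
  exact Finset.single_le_sum (f := fun i => ‖v i‖) (fun i _ => norm_nonneg _)
    (Finset.mem_Icc.2 ⟨Int.floor_mono h2.1, Int.floor_mono h2.2⟩)

/-- The map that sends a spin configuration to its chirality, an element of `L¹(I; ℝ³)`. -/
noncomputable def chirality (lam δ : ℝ) (u : ℤ → E3) : L1I :=
  (memLp_interpolation lam (chiralityAt lam δ u)).toLp _

/-- The constrained energy of `z ∈ L¹(I; ℝ³)`: the infimum of the energies of the configurations
with values in `circles Q` whose chirality is `z`; it is `+∞` if there is none. -/
noncomputable def constrainedEnergy (lam δ : ℝ) (Q : Set E3) (z : L1I) : ℝ≥0∞ :=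
  ⨅ (u : ℤ → E3) (_ : IsConfig lam (circles Q) u ∧ chirality lam δ u = z),
    ENNReal.ofReal (slicedEnergy lam δ u)

/-- Kuratowski convergence of a sequence of sets `E n` to the closed set `F`. -/
def KuratowskiTendsto (E : ℕ → Set E3) (F : Set E3) : Prop :=
  IsClosed F ∧
  (∀ x : ℕ → E3, (∀ n, x n ∈ E n) → ∀ p, MapClusterPt p atTop x → p ∈ F) ∧
  (∀ p ∈ F, ∃ x : ℕ → E3, (∀ n, x n ∈ E n) ∧ Tendsto x atTop (𝓝 p))

/-- Piecewise constant functions of bounded variation on the interval `I` with values in `A`: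
there are finitely many points `0 = t₀ < t₁ < ⋯ < t_m = 1` such that `z` is (almost everywhere)
equal to a constant element of `A` on each interval `(t_i, t_(i+1))`. -/
def IsBVpc (A : Set E3) (z : L1I) : Prop :=
  ∃ (m : ℕ) (t : Fin (m + 1) → ℝ) (c : Fin m → E3),
    StrictMono t ∧ t 0 = 0 ∧ t (Fin.last m) = 1 ∧ (∀ i, c i ∈ A) ∧
    ∀ i : Fin m, ∀ᵐ x ∂(volume.restrict (Ioo (t i.castSucc) (t i.succ))), z x = c i

end HelicalXY

open HelicalXY

/-!
Let `d = δ ^ (1/4)`, let `e m = u m - 2 (1 - δ) u (m+1) + u (m+2)` be the defect of a configuration,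
`z m` its rescaled angular velocity and `ν m = z m / |z m|`. The energy bound, used for an almost
optimal configuration with the given chirality, says `∑ |e m|² ≤ a² d⁶`. Splitting `e m` into its
component along `u (m+1)` and the orthogonal one gives a discrete Modica-Mortola structure:
the first controls `|z m|² + |z (m+1)|² - 2` by `|e m| / d⁴`, the second `|z (m+1) - z m|` by
`|e m| / d²`. This has two consequences. The lengths `|z|` tend to `1` in `L¹`
(`IsLowEnergyChain.lintegral_abs_norm_sub_one_le`). A window of about `d⁻²` indices in which `|z|`
drops below `1/2` carries energy of order `d⁶` (`IsLowEnergyChain.le_sum_of_norm_chir_lt`), so the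
number of such windows is bounded independently of `n`, while their length `λ d⁻²` tends to `0`
(`IsLowEnergyChain.exists_points`).

The constraint enters through the rigidity of `ν` on stretches where `|z| ≥ 1/2`. Among `k + 1`
consecutive spins two lie on the same great circle, with normal `q`. The function `q · u` satisfies
the helical recursion up to the error `|e|` and has two zeros in the block, so by a Rolle-type
argument (`abs_le_of_recursion_of_two_zeros`) it is small together with its increments; hence `ν` is
close to `± q` on the whole block, with an error bounded by `d⁻² ∑ |e|` over the block. Since `ν`
moves in small steps, the distance it travels is at most the total length of intervals around the
`2 k` possible values `± q`, which by the Cauchy-Schwarz inequality is of order `k d → 0`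
(`IsLowEnergyChain.norm_normalize_chir_sub_le`). Applying Cauchy-Schwarz also to the sum over the
normals is essential: estimating each of the `k` radii by the total energy gives `√k d` for each,
and only `k^(3/2) d` for the sum.

Passing to a subsequence, the exceptional windows converge to finitely many points, and `ν`
converges pointwise to a constant on each interval between them
(`exists_subseq_tendsto_piecewise`). The constants are limits of `± q`, so they lie in `Qbar ∪ -Qbar`
(`KuratowskiTendsto.mem_union_neg_of_tendsto`), and dominated convergence for `ν` together with
`|z| → 1` gives convergence in `L¹`.
-/

namespace HelicalXY

/-! ### The vector product and normalization -/

theorem cross_ofLp_zero (a b : E3) : cross a b 0 = a 1 * b 2 - a 2 * b 1 := by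
  simp [cross, cross_apply]

theorem cross_ofLp_one (a b : E3) : cross a b 1 = a 2 * b 0 - a 0 * b 2 := by
  simp [cross, cross_apply]

theorem cross_ofLp_two (a b : E3) : cross a b 2 = a 0 * b 1 - a 1 * b 0 := by
  simp [cross, cross_apply]

theorem inner_eq_coord (a b : E3) : inner ℝ a b = a 0 * b 0 + a 1 * b 1 + a 2 * b 2 := by
  simp [PiLp.inner_apply, Fin.sum_univ_three, mul_comm]

theorem norm_sq_eq_coord (a : E3) : ‖a‖ ^ 2 = a 0 ^ 2 + a 1 ^ 2 + a 2 ^ 2 := by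
  rw [← real_inner_self_eq_norm_sq, inner_eq_coord]; ring

/-- Lagrange's identity. -/
theorem norm_cross_sq (a b : E3) :
    ‖cross a b‖ ^ 2 = ‖a‖ ^ 2 * ‖b‖ ^ 2 - inner ℝ a b ^ 2 := by
  simp only [norm_sq_eq_coord, inner_eq_coord, cross_ofLp_zero, cross_ofLp_one, cross_ofLp_two]
  ring

theorem cross_smul_right (c : ℝ) (a b : E3) : cross a (c • b) = c • cross a b := by
  simp [cross]

theorem continuous_cross : Continuous fun p : E3 × E3 => cross p.1 p.2 := by
  refine (PiLp.continuous_toLp 2 _).comp (continuous_pi fun i => ?_)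
  fin_cases i <;> simp [cross_apply] <;> fun_prop

theorem cross_cross_eq (q u v : E3) :
    cross q (cross u v) = inner ℝ q (v - u) • u - inner ℝ q u • (v - u) := by
  ext i
  fin_cases i <;>
    simp [cross_ofLp_zero, cross_ofLp_one, cross_ofLp_two, inner_eq_coord] <;> ring

/-- Unit vectors with small vector product are nearly parallel or nearly antiparallel. -/
theorem norm_sub_le_or_norm_add_le_of_norm_cross_le {q v : E3} (hq : ‖q‖ = 1) (hv : ‖v‖ = 1)
    {r : ℝ} (h : ‖cross q v‖ ≤ r) : ‖v - q‖ ≤ 2 * r ∨ ‖v - (-q)‖ ≤ 2 * r := by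
  have hc := norm_cross_sq q v
  have hr : 0 ≤ r := (norm_nonneg _).trans h
  have h1 := norm_sub_sq_real v q
  have h2 := norm_add_sq_real v q
  rw [real_inner_comm] at h1 h2
  rw [hq, hv] at hc h1 h2
  have h3 : ‖cross q v‖ ^ 2 ≤ r ^ 2 := by gcongr
  set c : ℝ := inner ℝ q v
  rw [sub_neg_eq_add]
  rcases le_total 0 c with h0 | h0
  · left
    refine abs_le_of_sq_le_sq' ?_ (by positivity) |>.2
    have : c ≤ 1 := by nlinarith [sq_nonneg ‖cross q v‖]
    nlinarith
  · right
    refine abs_le_of_sq_le_sq' ?_ (by positivity) |>.2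
    have : -1 ≤ c := by nlinarith [sq_nonneg ‖cross q v‖]
    nlinarith

theorem eq_or_eq_neg_of_cross_eq_zero {q v : E3} (hq : ‖q‖ = 1) (hv : ‖v‖ = 1)
    (h : cross q v = 0) : v = q ∨ v = -q := by
  rcases norm_sub_le_or_norm_add_le_of_norm_cross_le hq hv (r := 0) (by simp [h]) with h | h
  · left; simpa [sub_eq_zero] using h
  · right; simpa only [mul_zero, norm_le_zero_iff, sub_eq_zero] using h

/-- Normalization is Lipschitz with constant `4` away from the ball of radius `1/2`. -/
theorem norm_normalize_sub_le {x y : E3} (hx : 1 / 2 ≤ ‖x‖) (hy : 1 / 2 ≤ ‖y‖) :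
    ‖NormedSpace.normalize x - NormedSpace.normalize y‖ ≤ 4 * ‖x - y‖ := by
  have hx0 : 0 < ‖x‖ := by linarith
  have hy0 : 0 < ‖y‖ := by linarith
  have e : NormedSpace.normalize x - NormedSpace.normalize y
      = ‖x‖⁻¹ • ((x - y) + (‖y‖ - ‖x‖) • NormedSpace.normalize y) := by
    simp only [NormedSpace.normalize, smul_add, smul_sub, smul_smul, sub_mul, mul_sub]
    rw [mul_inv_cancel₀ hy0.ne', inv_mul_cancel_left₀ hx0.ne']
    module
  have h1 : ‖NormedSpace.normalize y‖ = 1 := by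
    rw [NormedSpace.norm_normalize_eq_one_iff]; exact norm_pos_iff.1 hy0
  have h2 : |‖y‖ - ‖x‖| ≤ ‖x - y‖ := by rw [abs_sub_comm]; exact abs_norm_sub_norm_le x y
  have h3 : ‖x‖⁻¹ ≤ 2 := by rw [inv_le_comm₀ hx0 (by norm_num)]; linarith
  rw [e, norm_smul, norm_inv, norm_norm]
  have h4 : ‖(x - y) + (‖y‖ - ‖x‖) • NormedSpace.normalize y‖ ≤ 2 * ‖x - y‖ := by
    refine (norm_add_le _ _).trans ?_
    rw [norm_smul, h1, mul_one, Real.norm_eq_abs]; linarith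
  calc _ ≤ 2 * (2 * ‖x - y‖) := by gcongr
    _ = _ := by ring

theorem norm_cross_normalize_le {p z : E3} (hz : 1 / 2 ≤ ‖z‖) :
    ‖cross p (NormedSpace.normalize z)‖ ≤ 2 * ‖cross p z‖ := by
  have hz0 : 0 < ‖z‖ := by linarith
  have h3 : ‖z‖⁻¹ ≤ 2 := by rw [inv_le_comm₀ hz0 (by norm_num)]; linarith
  rw [NormedSpace.normalize, cross_smul_right, norm_smul, norm_inv, norm_norm]
  gcongr

theorem norm_normalize_le_one (x : E3) : ‖NormedSpace.normalize x‖ ≤ 1 := by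
  by_cases hx : x = 0
  · simp [hx]
  · exact (NormedSpace.norm_normalize_eq_one_iff.2 hx).le

theorem norm_sub_normalize_le (x : E3) :
    ‖x - NormedSpace.normalize x‖ ≤ |‖x‖ - 1| := by
  by_cases hx : x = 0
  · simp [hx]
  · have e : x - NormedSpace.normalize x = (‖x‖ - 1) • NormedSpace.normalize x := by
      rw [sub_smul, NormedSpace.norm_smul_normalize, one_smul]
    rw [e, norm_smul, NormedSpace.norm_normalize_eq_one_iff.2 hx, mul_one, Real.norm_eq_abs]

/-! ### Local estimates for nearly helical spin chains -/

/-- The defect of a spin chain from the helical recursion `u (m+2) = 2 (1-δ) u (m+1) - u m`,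
with `δ = d ^ 4`; its square is the energy density. -/
noncomputable def defect (d : ℝ) (u : ℕ → E3) (m : ℕ) : E3 :=
  u m - (2 * (1 - d ^ 4)) • u (m + 1) + u (m + 2)

/-- The rescaled angular velocity of a spin chain indexed by `ℕ`, with `δ = d ^ 4`. -/
noncomputable def chir (d : ℝ) (u : ℕ → E3) (m : ℕ) : E3 :=
  (Real.sqrt (2 * d ^ 4))⁻¹ • cross (u m) (u (m + 1))

theorem sqrt_two_mul_pow_four (d : ℝ) : Real.sqrt (2 * d ^ 4) = Real.sqrt 2 * d ^ 2 := by
  rw [Real.sqrt_mul (by norm_num), show d ^ 4 = (d ^ 2) ^ 2 by ring, Real.sqrt_sq (sq_nonneg d)]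

theorem sq_le_sqrt_two_mul_pow_four (d : ℝ) : d ^ 2 ≤ Real.sqrt (2 * d ^ 4) := by
  rw [sqrt_two_mul_pow_four]
  have : (1 : ℝ) ≤ Real.sqrt 2 := Real.one_le_sqrt.2 (by norm_num)
  nlinarith [sq_nonneg d]

theorem cross_sub_smul_add (a b c : E3) (r : ℝ) :
    cross b (a - r • b + c) = cross b c - cross a b := by
  ext i
  fin_cases i <;>
    simp [cross_ofLp_zero, cross_ofLp_one, cross_ofLp_two] <;> ring

theorem cross_defect (d : ℝ) (u : ℕ → E3) (m : ℕ) :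
    cross (u (m + 1)) (defect d u m)
      = cross (u (m + 1)) (u (m + 2)) - cross (u m) (u (m + 1)) := by
  rw [defect, cross_sub_smul_add]

theorem norm_chir_succ_sub_le {d : ℝ} (hd : 0 < d) {u : ℕ → E3} {m : ℕ}
    (h1 : ‖u (m + 1)‖ = 1) :
    ‖chir d u (m + 1) - chir d u m‖ ≤ ‖defect d u m‖ / d ^ 2 := by
  have h := norm_cross_sq (u (m + 1)) (defect d u m)
  have h2 : ‖cross (u (m + 1)) (defect d u m)‖ ≤ ‖defect d u m‖ := by
    refine abs_le_of_sq_le_sq' ?_ (norm_nonneg _) |>.2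
    rw [h, h1]
    nlinarith [sq_nonneg (inner ℝ (u (m + 1)) (defect d u m))]
  have hs := sq_le_sqrt_two_mul_pow_four d
  have hd2 : 0 < d ^ 2 := by positivity
  have e : chir d u (m + 1) - chir d u m
      = (Real.sqrt (2 * d ^ 4))⁻¹ • cross (u (m + 1)) (defect d u m) := by
    rw [cross_defect, smul_sub, chir, chir, add_assoc, one_add_one_eq_two]
  rw [e, norm_smul, norm_inv, Real.norm_eq_abs, abs_of_nonneg (Real.sqrt_nonneg _), div_eq_inv_mul]
  exact mul_le_mul (inv_anti₀ hd2 hs) h2 (norm_nonneg _) (inv_nonneg.2 hd2.le)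

theorem norm_sub_sq_of_unit {a b : E3} (ha : ‖a‖ = 1) (hb : ‖b‖ = 1) :
    ‖b - a‖ ^ 2 = 2 * (1 - inner ℝ a b) := by
  rw [norm_sub_sq_real, ha, hb, real_inner_comm]; ring

/-- The component of the defect along the middle spin. -/
theorem abs_inner_add_inner_le {d : ℝ} {u : ℕ → E3} {m : ℕ} (h1 : ‖u (m + 1)‖ = 1) :
    |(1 - inner ℝ (u m) (u (m + 1))) + (1 - inner ℝ (u (m + 1)) (u (m + 2))) - 2 * d ^ 4|
      ≤ ‖defect d u m‖ := by
  have e : inner ℝ (u (m + 1)) (defect d u m)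
      = -((1 - inner ℝ (u m) (u (m + 1))) + (1 - inner ℝ (u (m + 1)) (u (m + 2)))
        - 2 * d ^ 4) := by
    rw [defect, inner_add_right, inner_sub_right, inner_smul_right, real_inner_self_eq_norm_sq,
      h1, real_inner_comm (u m)]
    ring
  have := abs_real_inner_le_norm (u (m + 1)) (defect d u m)
  rwa [e, abs_neg, h1, one_mul] at this

theorem norm_chir_sq {d : ℝ} (hd : 0 < d) {u : ℕ → E3} {m : ℕ}
    (h0 : ‖u m‖ = 1) (h1 : ‖u (m + 1)‖ = 1) :
    2 * d ^ 4 * ‖chir d u m‖ ^ 2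
      = (1 - inner ℝ (u m) (u (m + 1))) * (1 + inner ℝ (u m) (u (m + 1))) := by
  rw [chir, norm_smul, mul_pow, norm_cross_sq, h0, h1, norm_inv, inv_pow, Real.norm_eq_abs,
    sq_abs, Real.sq_sqrt (by positivity)]
  field_simp
  ring

theorem one_sub_inner_nonneg {a b : E3} (ha : ‖a‖ = 1) (hb : ‖b‖ = 1) :
    0 ≤ 1 - inner ℝ a b := by
  have := real_inner_le_norm a b
  rw [ha, hb] at this
  linarith

/-- The scalar computation behind `abs_norm_chir_sub_one_le`: `s = 1 - cos θ` for the angle `θ`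
between neighbouring spins, `σ = s / δ`, and `x` is the length of the angular velocity. -/
theorem abs_sub_one_le_of_pair {s s' σ σ' x x' t r ζ : ℝ} (hs0 : 0 ≤ s) (hs1 : 0 ≤ s')
    (hσ0 : 0 ≤ σ) (hσ1 : 0 ≤ σ') (hx0 : 0 ≤ x) (hx1 : 0 ≤ x') (ht0 : 0 ≤ t) (hζ0 : 0 ≤ ζ)
    (hζ1 : ζ ≤ 1) (hsζ : s + s' ≤ ζ) (hx0' : x ^ 2 = σ - σ * s / 2)
    (hx1' : x' ^ 2 = σ' - σ' * s' / 2) (hup : σ + σ' - 2 ≤ t) (hlo : -t ≤ σ + σ' - 2)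
    (hD' : |x' - x| ≤ r) (hDt : r ≤ t) (hD1 : r ≤ 1) :
    |x - 1| ≤ 2 * t + ζ ∧ |x' - 1| ≤ 2 * t + ζ := by
  have hq0 : σ * s ≤ σ * ζ := by gcongr; linarith
  have hq1 : σ' * s' ≤ σ' * ζ := by gcongr; linarith
  have hq0' : 0 ≤ σ * s := by positivity
  have hq1' : 0 ≤ σ' * s' := by positivity
  have hq2 : (σ + σ') * ζ ≤ 2 * ζ + t :=
    calc (σ + σ') * ζ ≤ (2 + t) * ζ := mul_le_mul_of_nonneg_right (by linarith) hζ0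
      _ = 2 * ζ + t * ζ := by ring
      _ ≤ 2 * ζ + t * 1 := by linarith [mul_le_mul_of_nonneg_left hζ1 ht0]
      _ = 2 * ζ + t := by ring
  have hsum1 : x ^ 2 + x' ^ 2 - 2 ≤ t := by linarith
  have hsum2 : -(3 / 2 * t + ζ) ≤ x ^ 2 + x' ^ 2 - 2 := by linarith
  have hxx : x + x' ≤ 2 + t / 2 := by nlinarith [sq_nonneg (x - 1), sq_nonneg (x' - 1)]
  have hdiff : |x' ^ 2 - x ^ 2| ≤ 5 / 2 * t := by
    rw [show x' ^ 2 - x ^ 2 = (x' - x) * (x + x') by ring, abs_mul,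
      abs_of_nonneg (add_nonneg hx0 hx1)]
    calc |x' - x| * (x + x') ≤ r * (2 + t / 2) := by
          exact mul_le_mul hD' hxx (add_nonneg hx0 hx1) ((abs_nonneg _).trans hD')
      _ = 2 * r + r * t / 2 := by ring
      _ ≤ 5 / 2 * t := by linarith [mul_le_mul_of_nonneg_right hD1 ht0]
  have hdiff2 := abs_le.1 hdiff
  have key : ∀ y : ℝ, 0 ≤ y → |y - 1| ≤ |y ^ 2 - 1| := by
    intro y hy
    rw [show y ^ 2 - 1 = (y - 1) * (y + 1) by ring, abs_mul,
      abs_of_nonneg (by linarith : 0 ≤ y + 1)]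
    exact le_mul_of_one_le_right (abs_nonneg _) (by linarith)
  constructor
  · refine (key x hx0).trans (abs_le.2 ⟨?_, ?_⟩) <;> linarith [hdiff2.1, hdiff2.2]
  · refine (key x' hx1).trans (abs_le.2 ⟨?_, ?_⟩) <;> linarith [hdiff2.1, hdiff2.2]

/-- Where the defect is small, both angular velocities have nearly unit length: the defect
controls the sum of the squared lengths through its component along the middle spin, and their
difference through the orthogonal one. -/
theorem abs_norm_chir_sub_one_le {a d : ℝ} (hd : 0 < d) (hd1 : d ≤ 1) (had : a * d ≤ 1)
    (hsmall : 2 * d ^ 4 + a * d ^ 3 ≤ 1) {u : ℕ → E3} {m : ℕ}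
    (h0 : ‖u m‖ = 1) (h1 : ‖u (m + 1)‖ = 1) (h2 : ‖u (m + 2)‖ = 1)
    (he : ‖defect d u m‖ ≤ a * d ^ 3) :
    |‖chir d u m‖ - 1| ≤ 2 * (‖defect d u m‖ / d ^ 4) + (2 * d ^ 4 + a * d ^ 3) ∧
      |‖chir d u (m + 1)‖ - 1| ≤ 2 * (‖defect d u m‖ / d ^ 4) + (2 * d ^ 4 + a * d ^ 3) := by
  have hs0 := one_sub_inner_nonneg h0 h1
  have hs1 := one_sub_inner_nonneg h1 h2
  have hy0 := norm_chir_sq hd h0 h1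
  have hy1 := norm_chir_sq hd h1 h2
  have hP := abs_inner_add_inner_le (d := d) (u := u) (m := m) h1
  have hD := norm_chir_succ_sub_le hd (u := u) (m := m) h1
  have hD' := (abs_norm_sub_norm_le (chir d u (m + 1)) (chir d u m)).trans hD
  have hx0 := norm_nonneg (chir d u m)
  have hx1 := norm_nonneg (chir d u (m + 1))
  have he0 := norm_nonneg (defect d u m)
  have hd2 : 0 < d ^ 2 := by positivity
  have hd4 : 0 < d ^ 4 := by positivity
  rw [show m + 1 + 1 = m + 2 from rfl] at hy1
  set s := 1 - inner ℝ (u m) (u (m + 1))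
  set s' := 1 - inner ℝ (u (m + 1)) (u (m + 2))
  rw [show 1 + inner ℝ (u m) (u (m + 1)) = 2 - s by simp only [s]; ring] at hy0
  rw [show 1 + inner ℝ (u (m + 1)) (u (m + 2)) = 2 - s' by simp only [s']; ring] at hy1
  set ε := ‖defect d u m‖
  set x := ‖chir d u m‖
  set x' := ‖chir d u (m + 1)‖
  set ζ := 2 * d ^ 4 + a * d ^ 3 with hζ
  set t := ε / d ^ 4 with ht
  have ht0 : 0 ≤ t := by positivity
  have het : ε = t * d ^ 4 := by rw [ht]; field_simp
  have hDt : ε / d ^ 2 ≤ t := by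
    rw [ht]; gcongr 1; exact pow_le_pow_of_le_one hd.le hd1 (by norm_num)
  have hD1 : ε / d ^ 2 ≤ 1 := by
    rw [div_le_one hd2]; nlinarith
  have hP2 := abs_le.1 hP
  have hD2 := abs_le.1 hD'
  have hsζ : s + s' ≤ ζ := by linarith
  obtain ⟨σ, hσ⟩ : ∃ σ, s = σ * d ^ 4 := ⟨s / d ^ 4, by field_simp⟩
  obtain ⟨σ', hσ'⟩ : ∃ σ, s' = σ * d ^ 4 := ⟨s' / d ^ 4, by field_simp⟩
  have hσ0 : 0 ≤ σ := by rw [hσ] at hs0; exact nonneg_of_mul_nonneg_left hs0 hd4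
  have hσ1 : 0 ≤ σ' := by rw [hσ'] at hs1; exact nonneg_of_mul_nonneg_left hs1 hd4
  have hx0' : x ^ 2 = σ - σ * s / 2 := by
    have : d ^ 4 * (2 * x ^ 2 - 2 * σ + σ * s) = 0 := by
      linear_combination hy0 + (2 - s) * hσ
    have := (mul_eq_zero.1 this).resolve_left hd4.ne'
    linarith
  have hx1' : x' ^ 2 = σ' - σ' * s' / 2 := by
    have : d ^ 4 * (2 * x' ^ 2 - 2 * σ' + σ' * s') = 0 := by
      linear_combination hy1 + (2 - s') * hσ'
    have := (mul_eq_zero.1 this).resolve_left hd4.ne'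
    linarith
  have hup : σ + σ' - 2 ≤ t := by
    refine le_of_mul_le_mul_right ?_ hd4
    rw [het, hσ, hσ'] at hP2
    linarith [hP2.2]
  have hlo : -t ≤ σ + σ' - 2 := by
    refine le_of_mul_le_mul_right ?_ hd4
    rw [het, hσ, hσ'] at hP2
    linarith [hP2.1]
  have hζ0 : 0 ≤ ζ := by linarith
  exact abs_sub_one_le_of_pair hs0 hs1 hσ0 hσ1 hx0 hx1 ht0 hζ0 hsmall hsζ hx0' hx1' hup hlo
    hD' hDt hD1

theorem mul_norm_sub_le_one {a d : ℝ} {u : ℕ → E3} {m : ℕ}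
    (h0 : ‖u m‖ = 1) (h1 : ‖u (m + 1)‖ = 1) (h2 : ‖u (m + 2)‖ = 1)
    (he : ‖defect d u m‖ ≤ a * d ^ 3) {k : ℝ} (hk : k ^ 2 * (4 * d ^ 4 + 2 * a * d ^ 3) ≤ 1) :
    k * ‖u (m + 1) - u m‖ ≤ 1 := by
  have hs1 := one_sub_inner_nonneg h1 h2
  have hP := (abs_le.1 (abs_inner_add_inner_le (d := d) (u := u) (m := m) h1)).2
  have hw := norm_sub_sq_of_unit h0 h1
  refine abs_le_of_sq_le_sq' ?_ (by norm_num) |>.2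
  calc (k * ‖u (m + 1) - u m‖) ^ 2 = k ^ 2 * ‖u (m + 1) - u m‖ ^ 2 := by ring
    _ ≤ k ^ 2 * (4 * d ^ 4 + 2 * a * d ^ 3) := by gcongr; linarith
    _ ≤ 1 ^ 2 := by linarith

/-- A Rolle-type estimate for an approximate solution `f` of the helical recursion with two zeros
in a block of length `k`: on the whole block, `f` and its increments are controlled by the sum of
the errors, with no contribution of the zeroth-order term `2 η f`. -/
theorem abs_le_of_recursion_of_two_zeros {f ε : ℕ → ℝ} {η : ℝ} {k a b : ℕ} (hη : 0 ≤ η)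
    (hk : 4 * η * k ^ 2 ≤ 1) (hε : ∀ m, 0 ≤ ε m)
    (hrec : ∀ m, |f m - 2 * (1 - η) * f (m + 1) + f (m + 2)| ≤ ε m)
    (hab : a < b) (hbk : b ≤ k) (ha : f a = 0) (hb : f b = 0) {m : ℕ} (hm : m < k) :
    |f (m + 1) - f m| ≤ 2 * ∑ i ∈ Finset.range k, ε i ∧
      |f m| ≤ k * (2 * ∑ i ∈ Finset.range k, ε i) := by
  set S := ∑ i ∈ Finset.range k, ε i
  set g : ℕ → ℝ := fun i => f (i + 1) - f i with hg
  obtain ⟨M, hMk, hM⟩ := Finset.exists_max_image (Finset.range k) (fun i => |g i|)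
    ⟨m, Finset.mem_range.2 hm⟩
  set G := |g M|
  have hG0 : 0 ≤ G := abs_nonneg _
  have hfdiff : ∀ i j, i ≤ j → j ≤ k → dist (f i) (f j) ≤ k * G := by
    intro i j hij hj
    refine (dist_le_Ico_sum_dist f hij).trans ?_
    calc ∑ r ∈ Finset.Ico i j, dist (f r) (f (r + 1)) ≤ ∑ r ∈ Finset.Ico i j, G := by
          refine Finset.sum_le_sum fun r hr => ?_
          rw [dist_comm, Real.dist_eq]
          exact hM r (Finset.mem_range.2 ((Finset.mem_Ico.1 hr).2.trans_le hj))
      _ = ((j - i : ℕ) : ℝ) * G := by simp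
      _ ≤ k * G := by gcongr; omega
  have hf : ∀ j, j ≤ k → |f j| ≤ k * G := by
    intro j hj
    rcases le_total a j with h | h
    · simpa [Real.dist_eq, ha] using hfdiff a j h hj
    · simpa [Real.dist_eq, ha] using hfdiff j a h (hab.le.trans hbk)
  -- `V` bounds the variation of `g`; as `g` has mean zero on `[a, b)`, it also bounds `|g|`, and
  -- the second summand is at most `G / 2` by smallness of `η * k ^ 2`.
  set V := S + k * (2 * η * (k * G)) with hV
  have hgdiff : ∀ i j, i ≤ j → j < k → dist (g i) (g j) ≤ V := by
    intro i j hij hj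
    refine (dist_le_Ico_sum_dist g hij).trans ?_
    calc ∑ r ∈ Finset.Ico i j, dist (g r) (g (r + 1))
        ≤ ∑ r ∈ Finset.Ico i j, (ε r + 2 * η * (k * G)) := by
          refine Finset.sum_le_sum fun r hr => ?_
          have hr2 := (Finset.mem_Ico.1 hr).2
          have e : g (r + 1) - g r
              = (f r - 2 * (1 - η) * f (r + 1) + f (r + 2)) - 2 * η * f (r + 1) := by
            simp only [hg]; ring
          rw [dist_comm, Real.dist_eq, e]
          refine (abs_sub _ _).trans (add_le_add (hrec r) ?_)
          rw [abs_mul, abs_of_nonneg (by positivity : 0 ≤ 2 * η)]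
          have := hf (r + 1) (by omega)
          gcongr
      _ ≤ ∑ r ∈ Finset.range k, (ε r + 2 * η * (k * G)) := by
          refine Finset.sum_le_sum_of_subset_of_nonneg ?_ fun r _ _ => ?_
          · intro r hr
            exact Finset.mem_range.2 ((Finset.mem_Ico.1 hr).2.trans hj)
          · have := hε r; positivity
      _ = V := by rw [Finset.sum_add_distrib]; simp [hV, S]
  have hgdiff' : ∀ i j, i < k → j < k → |g i - g j| ≤ V := by
    intro i j hi hj
    rw [← Real.dist_eq]
    rcases le_total i j with h | h
    · exact hgdiff i j h hj
    · rw [dist_comm]; exact hgdiff j i h hi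
  have hsum : ∑ i ∈ Finset.Ico a b, g i = 0 := by
    rw [Finset.sum_Ico_sub f hab.le, ha, hb, sub_zero]
  have hne : (Finset.Ico a b).Nonempty := Finset.nonempty_Ico.2 hab
  obtain ⟨i₀, hi₀, h₀⟩ : ∃ i ∈ Finset.Ico a b, g i ≤ 0 := by
    by_contra! h
    exact (Finset.sum_pos h hne).ne' hsum
  obtain ⟨i₁, hi₁, h₁⟩ : ∃ i ∈ Finset.Ico a b, 0 ≤ g i := by
    by_contra! h
    exact (Finset.sum_neg h hne).ne hsum
  have hi₀k : i₀ < k := (Finset.mem_Ico.1 hi₀).2.trans_le hbk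
  have hi₁k : i₁ < k := (Finset.mem_Ico.1 hi₁).2.trans_le hbk
  have hMk' := Finset.mem_range.1 hMk
  have hGV : G ≤ V := by
    refine abs_le.2 ⟨?_, ?_⟩
    · linarith [(abs_le.1 (hgdiff' M i₁ hMk' hi₁k)).1]
    · linarith [(abs_le.1 (hgdiff' M i₀ hMk' hi₀k)).2]
  have hG2 : G ≤ 2 * S := by
    have : (4 * η * k ^ 2) * G ≤ 1 * G := by gcongr
    nlinarith
  exact ⟨(hM m (Finset.mem_range.2 hm)).trans hG2, (hf m hm.le).trans (by gcongr)⟩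

/-- Among `k + 1` consecutive spins on `k` great circles, two lie on the same circle. Its normal
vector is then almost parallel to all angular velocities in the block. -/
theorem exists_norm_cross_cross_le {d : ℝ} {u : ℕ → E3} {k : ℕ} {q : Fin k → E3}
    (hq : ∀ l, ‖q l‖ = 1) (hu : ∀ m ≤ k, ‖u m‖ = 1)
    (hc : ∀ m ≤ k, ∃ l, inner ℝ (q l) (u m) = 0) (hd : 4 * d ^ 4 * k ^ 2 ≤ 1)
    (hw : ∀ m < k, k * ‖u (m + 1) - u m‖ ≤ 1) :
    ∃ l, ∀ m < k, ‖cross (q l) (cross (u m) (u (m + 1)))‖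
      ≤ 4 * ∑ i ∈ Finset.range k, ‖defect d u i‖ := by
  choose c hc using fun m : Fin (k + 1) => hc m (Nat.lt_succ_iff.1 m.2)
  obtain ⟨x, y, hxy, hcxy⟩ := Fintype.exists_ne_map_eq_of_card_lt c (by simp)
  wlog hlt : x < y generalizing x y
  · exact this y x hxy.symm hcxy.symm (lt_of_le_of_ne (not_lt.1 hlt) hxy.symm)
  refine ⟨c x, fun m hm => ?_⟩
  set S := ∑ i ∈ Finset.range k, ‖defect d u i‖
  have hrec : ∀ i, |inner ℝ (q (c x)) (u i) - 2 * (1 - d ^ 4) * inner ℝ (q (c x)) (u (i + 1))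
      + inner ℝ (q (c x)) (u (i + 2))| ≤ ‖defect d u i‖ := by
    intro i
    have h := abs_real_inner_le_norm (q (c x)) (defect d u i)
    rwa [defect, inner_add_right, inner_sub_right, inner_smul_right, hq, one_mul] at h
  obtain ⟨h1, h2⟩ := abs_le_of_recursion_of_two_zeros (by positivity) hd
    (fun i => norm_nonneg (defect d u i)) hrec (a := x) (b := y) hlt (Nat.lt_succ_iff.1 y.2)
    (hc x) (by rw [hcxy]; exact hc y) hm
  rw [← inner_sub_right] at h1
  rw [cross_cross_eq]
  refine (norm_sub_le _ _).trans ?_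
  rw [norm_smul, norm_smul, hu m hm.le, mul_one, Real.norm_eq_abs, Real.norm_eq_abs]
  have hS : 0 ≤ S := Finset.sum_nonneg fun i _ => norm_nonneg _
  have h3 : |inner ℝ (q (c x)) (u m)| * ‖u (m + 1) - u m‖ ≤ 2 * S :=
    calc _ ≤ (k * (2 * S)) * ‖u (m + 1) - u m‖ := by gcongr
      _ = (k * ‖u (m + 1) - u m‖) * (2 * S) := by ring
      _ ≤ 1 * (2 * S) := by gcongr; exact hw m hm
      _ = 2 * S := one_mul _
  linarith

/-! ### Chains of low energy: rigidity of the direction of the angular velocity -/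

/-- A chain `u 0, …, u N` of unit vectors on the great circles orthogonal to `q 0, …, q (k-1)`
whose total squared defect is at most `a ^ 2 * d ^ 6`. The last three conditions say that `d` is
small in terms of `a` and `k`; they hold eventually if `a` is fixed, `d → 0` and `k * d → 0`. -/
structure IsLowEnergyChain (N : ℕ) {k : ℕ} (q : Fin k → E3) (a d : ℝ) (u : ℕ → E3) : Prop where
  a_nonneg : 0 ≤ a
  d_pos : 0 < d
  d_le_one : d ≤ 1
  norm_normal : ∀ l, ‖q l‖ = 1
  norm_eq_one : ∀ m ≤ N, ‖u m‖ = 1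
  mem_circle : ∀ m ≤ N, ∃ l, inner ℝ (q l) (u m) = 0
  sum_le : ∑ m ∈ Finset.range (N - 1), ‖defect d u m‖ ^ 2 ≤ a ^ 2 * d ^ 6
  mul_le_one : a * d ≤ 1
  add_le : 2 * d ^ 4 + a * d ^ 3 ≤ 1 / 8
  sq_mul_le : (k : ℝ) ^ 2 * (4 * d ^ 4 + 2 * a * d ^ 3) ≤ 1

theorem sum_range_mul_eq (F : ℕ → ℝ) (s k T : ℕ) :
    ∑ b ∈ Finset.range T, ∑ i ∈ Finset.range k, F (s + b * k + i)
      = ∑ j ∈ Finset.range (T * k), F (s + j) := by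
  induction T with
  | zero => simp
  | succ T ih =>
    rw [Finset.sum_range_succ, ih, Nat.succ_mul, Finset.sum_range_add]
    simp only [add_assoc]

/-- An interval covered by finitely many closed intervals is no longer than their total length. -/
theorem le_sum_of_forall_mem_Ico {ι : Type*} [Fintype ι] {F : ℝ} {c ρ : ι → ℝ}
    (hρ : ∀ s, 0 ≤ ρ s) (h : ∀ t ∈ Ico 0 F, ∃ s, |t - c s| ≤ ρ s) : F ≤ ∑ s, 2 * ρ s := by
  have hsub : Ico 0 F ⊆ ⋃ s, Metric.closedBall (c s) (ρ s) := by
    intro t ht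
    obtain ⟨s, hs⟩ := h t ht
    exact mem_iUnion.2 ⟨s, by rwa [Metric.mem_closedBall, Real.dist_eq]⟩
  have h1 : ENNReal.ofReal F ≤ ENNReal.ofReal (∑ s, 2 * ρ s) := by
    calc ENNReal.ofReal F = volume (Ico 0 F) := by rw [Real.volume_Ico, sub_zero]
      _ ≤ volume (⋃ s, Metric.closedBall (c s) (ρ s)) := measure_mono hsub
      _ ≤ ∑ s, volume (Metric.closedBall (c s) (ρ s)) := measure_iUnion_fintype_le _ _
      _ = ENNReal.ofReal (∑ s, 2 * ρ s) := by
        rw [ENNReal.ofReal_sum_of_nonneg fun s _ => by have := hρ s; positivity]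
        simp only [Real.volume_closedBall]
  exact (ENNReal.ofReal_le_ofReal_iff (Finset.sum_nonneg fun s _ => by
    have := hρ s; positivity)).1 h1

theorem exists_le_lt_succ {f : ℕ → ℝ} {i j : ℕ} {t : ℝ} (hij : i ≤ j) (hi : f i ≤ t)
    (hj : t < f j) : ∃ m, i ≤ m ∧ m < j ∧ f m ≤ t ∧ t < f (m + 1) := by
  induction j, hij using Nat.le_induction with
  | base => exact absurd hj (not_lt.2 hi)
  | succ j hij ih =>
    rcases le_or_gt (f j) t with h | h
    · exact ⟨j, hij, j.lt_succ_self, h, hj⟩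
    · obtain ⟨m, h1, h2, h3⟩ := ih h
      exact ⟨m, h1, h2.trans j.lt_succ_self, h3⟩

namespace IsLowEnergyChain

variable {N k : ℕ} {q : Fin k → E3} {a d : ℝ} {u : ℕ → E3}

theorem norm_defect_le (h : IsLowEnergyChain N q a d u) {m : ℕ} (hm : m + 2 ≤ N) :
    ‖defect d u m‖ ≤ a * d ^ 3 := by
  have ha := h.a_nonneg
  have hd := h.d_pos
  have h1 : ‖defect d u m‖ ^ 2 ≤ (a * d ^ 3) ^ 2 := by
    refine (Finset.single_le_sum (f := fun i => ‖defect d u i‖ ^ 2) (fun i _ => sq_nonneg _)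
      (Finset.mem_range.2 (by omega : m < N - 1))).trans (h.sum_le.trans_eq ?_)
    ring
  exact abs_le_of_sq_le_sq' h1 (by positivity) |>.2

theorem sum_shift_le (h : IsLowEnergyChain N q a d u) {s L : ℕ} (hs : s + L + 1 ≤ N) :
    ∑ i ∈ Finset.range L, ‖defect d u (s + i)‖ ^ 2 ≤ a ^ 2 * d ^ 6 := by
  refine le_trans ?_ h.sum_le
  have e := Finset.sum_range_add (fun i => ‖defect d u i‖ ^ 2) s L
  have h0 : 0 ≤ ∑ i ∈ Finset.range s, ‖defect d u i‖ ^ 2 :=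
    Finset.sum_nonneg fun i _ => sq_nonneg _
  have h1 : ∑ i ∈ Finset.range (s + L), ‖defect d u i‖ ^ 2
      ≤ ∑ i ∈ Finset.range (N - 1), ‖defect d u i‖ ^ 2 :=
    Finset.sum_le_sum_of_subset_of_nonneg
      (Finset.range_subset_range.2 (by omega)) fun i _ _ => sq_nonneg _
  linarith

theorem exists_norm_cross_chir_le (h : IsLowEnergyChain N q a d u) {s : ℕ} (hs : s + k + 1 ≤ N) :
    ∃ l, ∀ m < k, ‖cross (q l) (chir d u (s + m))‖
      ≤ 4 * (∑ i ∈ Finset.range k, ‖defect d u (s + i)‖) / d ^ 2 := by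
  have ha := h.a_nonneg
  have hd := h.d_pos
  obtain ⟨l, hl⟩ := exists_norm_cross_cross_le (d := d) (u := fun m => u (s + m)) h.norm_normal
    (fun m hm => h.norm_eq_one _ (by omega)) (fun m hm => h.mem_circle _ (by omega))
    (by
      have := h.sq_mul_le
      have h0 : 0 ≤ (k : ℝ) ^ 2 * (2 * a * d ^ 3) := by positivity
      linarith)
    (fun m hm => mul_norm_sub_le_one (m := s + m) (h.norm_eq_one _ (by omega))
      (h.norm_eq_one _ (by omega)) (h.norm_eq_one _ (by omega)) (h.norm_defect_le (by omega))
      h.sq_mul_le)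
  refine ⟨l, fun m hm => ?_⟩
  have h1 := hl m hm
  have hd2 : 0 < d ^ 2 := by positivity
  rw [chir, cross_smul_right, norm_smul, norm_inv, Real.norm_eq_abs,
    abs_of_nonneg (Real.sqrt_nonneg _), div_eq_inv_mul]
  exact mul_le_mul (inv_anti₀ hd2 (sq_le_sqrt_two_mul_pow_four d)) h1 (norm_nonneg _)
    (inv_nonneg.2 hd2.le)

/-- Where it is not too short, the angular velocity is almost parallel to one of the normals. -/
theorem exists_norm_cross_normalize_le (h : IsLowEnergyChain N q a d u) {m : ℕ}
    (hm : m + k + 1 ≤ N) (hz : 1 / 2 ≤ ‖chir d u m‖) :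
    ∃ l, ‖cross (q l) (NormedSpace.normalize (chir d u m))‖ ≤ 8 * (k * d) * a := by
  have ha := h.a_nonneg
  have hd := h.d_pos
  obtain ⟨l, hl⟩ := h.exists_norm_cross_chir_le hm
  have hk : 0 < k := by
    obtain ⟨l, -⟩ := h.mem_circle 0 (Nat.zero_le _)
    exact l.pos
  refine ⟨l, (norm_cross_normalize_le hz).trans ?_⟩
  have h1 := hl 0 hk
  rw [add_zero] at h1
  have h2 : ∑ i ∈ Finset.range k, ‖defect d u (m + i)‖ ≤ k * (a * d ^ 3) := by
    refine (Finset.sum_le_sum fun i hi => h.norm_defect_le (m := m + i) ?_).trans ?_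
    · have := Finset.mem_range.1 hi; omega
    · simp
  calc 2 * ‖cross (q l) (chir d u m)‖ ≤ 2 * (4 * (k * (a * d ^ 3)) / d ^ 2) := by
        refine mul_le_mul_of_nonneg_left (h1.trans ?_) (by norm_num)
        gcongr
    _ = 8 * (k * d) * a := by field_simp; ring

/-- Rigidity of the direction: along a stretch on which the angular velocity is not too short, its
direction varies by at most a multiple of `k * d`. The stretch is cut into blocks of length `k`.
On each block the direction stays close to `± q l` for some `l`, so that the distances to the
initial direction fill intervals around the `2 * k` numbers `dist (± q l)`. The radius of the
interval for `l` is dominated by the `ℓ²`-sum over all blocks assigned to `l`; the path is connected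
up to small steps, so the distance it travels is at most the total length of the intervals, which
the Cauchy-Schwarz inequality bounds by the energy. -/
theorem norm_normalize_chir_sub_le (h : IsLowEnergyChain N q a d u) {i j : ℕ} (hij : i ≤ j)
    (hj : j + k + 1 ≤ N) (hz : ∀ m, i ≤ m → m ≤ j → 1 / 2 ≤ ‖chir d u m‖) :
    ‖NormedSpace.normalize (chir d u i) - NormedSpace.normalize (chir d u j)‖
      ≤ 80 * (k * d) * a := by
  have ha := h.a_nonneg
  have hd := h.d_pos
  have hk : 0 < k := by
    obtain ⟨l, -⟩ := h.mem_circle 0 (Nat.zero_le _)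
    exact l.pos
  have : Nonempty (Fin k) := ⟨⟨0, hk⟩⟩
  set ν : ℕ → E3 := fun m => NormedSpace.normalize (chir d u m) with hν
  have hν1 : ∀ m, i ≤ m → m ≤ j → ‖ν m‖ = 1 := fun m h1 h2 =>
    NormedSpace.norm_normalize_eq_one_iff.2 (norm_pos_iff.1 (by linarith [hz m h1 h2]))
  set S : ℕ → ℝ := fun b => ∑ r ∈ Finset.range k, ‖defect d u (i + b * k + r)‖ with hS
  have hS0 : ∀ b, 0 ≤ S b := fun b => Finset.sum_nonneg fun r _ => norm_nonneg _
  set T := (j - i) / k + 1 with hT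
  have hTk : i + T * k ≤ j + k := by
    have := Nat.div_mul_le_self (j - i) k
    rw [hT, Nat.succ_mul]; omega
  have hblock : ∀ b, b < T → i + b * k + k ≤ j + k := by
    intro b hb
    have : (b + 1) * k ≤ T * k := Nat.mul_le_mul_right k hb
    rw [Nat.succ_mul] at this
    omega
  have hex : ∀ b, b < T → ∃ l, ∀ m < k,
      ‖cross (q l) (chir d u (i + b * k + m))‖ ≤ 4 * S b / d ^ 2 := fun b hb =>
    h.exists_norm_cross_chir_le (by have := hblock b hb; omega)
  choose! l hl using hex
  -- The `ℓ²`-sum dominates each `S b` with `l b = p`, and can be summed over `p`.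
  set A : Fin k → ℝ := fun p => ∑ b ∈ Finset.range T with l b = p, S b ^ 2 with hA
  have hA0 : ∀ p, 0 ≤ A p := fun p => Finset.sum_nonneg fun b _ => sq_nonneg _
  have hSA : ∀ b < T, S b ≤ √(A (l b)) := fun b hb => by
    refine Real.le_sqrt_of_sq_le ?_
    exact Finset.single_le_sum (f := fun b => S b ^ 2) (fun b _ => sq_nonneg _)
      (Finset.mem_filter.2 ⟨Finset.mem_range.2 hb, rfl⟩)
  set ρ : Fin k × Bool → ℝ := fun s => 20 * √(A s.1) / d ^ 2 with hρ
  -- The Boolean records the sign in `± q l`.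
  set c : Fin k × Bool → ℝ := fun s => ‖ν i - (if s.2 then q s.1 else -q s.1)‖ with hc
  have hcover : ∀ t ∈ Ico 0 ‖ν i - ν j‖, ∃ s, |t - c s| ≤ ρ s := by
    intro t ht
    obtain ⟨m, him, hmj, h1, h2⟩ := exists_le_lt_succ (f := fun m => ‖ν i - ν m‖) hij
      (by simpa using ht.1) ht.2
    set b := (m - i) / k with hb
    have hbT : b < T := Nat.lt_succ_of_le (Nat.div_le_div_right (by omega))
    obtain ⟨r, hr, hmr⟩ : ∃ r < k, m = i + b * k + r := by
      refine ⟨(m - i) % k, Nat.mod_lt _ hk, ?_⟩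
      have : b * k + (m - i) % k = m - i := Nat.div_add_mod' (m - i) k
      omega
    have hD : ‖ν (m + 1) - ν m‖ ≤ 4 * S b / d ^ 2 := by
      refine (norm_normalize_sub_le (hz _ (by omega) (by omega)) (hz _ him hmj.le)).trans ?_
      have h3 := norm_chir_succ_sub_le hd (u := u) (h.norm_eq_one (m + 1) (by omega))
      have h4 : ‖defect d u m‖ ≤ S b := by
        rw [hmr]
        exact Finset.single_le_sum (f := fun r => ‖defect d u (i + b * k + r)‖)
          (fun r _ => norm_nonneg _) (Finset.mem_range.2 hr)
      calc 4 * ‖chir d u (m + 1) - chir d u m‖ ≤ 4 * (S b / d ^ 2) := by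
            refine mul_le_mul_of_nonneg_left (h3.trans ?_) (by norm_num)
            gcongr
        _ = 4 * S b / d ^ 2 := by ring
    have hcr : ‖cross (q (l b)) (ν m)‖ ≤ 8 * S b / d ^ 2 := by
      refine (norm_cross_normalize_le (hz _ him hmj.le)).trans ?_
      have := hl b hbT r hr
      rw [← hmr] at this
      calc _ ≤ 2 * (4 * S b / d ^ 2) := by gcongr
        _ = _ := by ring
    have hnear : ∃ e : Bool, ‖ν m - (if e then q (l b) else -q (l b))‖
        ≤ 2 * (8 * S b / d ^ 2) := by
      rcases norm_sub_le_or_norm_add_le_of_norm_cross_le (h.norm_normal _)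
        (hν1 m him hmj.le) hcr with h5 | h5
      · exact ⟨true, by simpa using h5⟩
      · exact ⟨false, by simpa using h5⟩
    obtain ⟨e, he⟩ := hnear
    refine ⟨(l b, e), ?_⟩
    set w : E3 := if e then q (l b) else -q (l b) with hw
    have hcw : c (l b, e) = ‖ν i - w‖ := rfl
    have e1 : |‖ν i - ν (m + 1)‖ - ‖ν i - ν m‖| ≤ ‖ν (m + 1) - ν m‖ := by
      refine (abs_norm_sub_norm_le _ _).trans_eq ?_
      rw [sub_sub_sub_cancel_left, norm_sub_rev]
    have e2 : |‖ν i - ν m‖ - ‖ν i - w‖| ≤ ‖ν m - w‖ := by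
      refine (abs_norm_sub_norm_le _ _).trans_eq ?_
      rw [sub_sub_sub_cancel_left, norm_sub_rev]
    have e3 : 20 * S b / d ^ 2 ≤ ρ (l b, e) := by
      simp only [hρ]
      gcongr
      exact hSA b hbT
    refine le_trans ?_ e3
    -- One step of the path costs `4`, the distance from `ν m` to `± q` costs `16`.
    have e4 : 20 * S b / d ^ 2 = 4 * S b / d ^ 2 + 2 * (8 * S b / d ^ 2) := by ring
    rw [e4, hcw]
    have f1 := abs_le.1 e1
    have f2 := abs_le.1 e2
    refine abs_le.2 ⟨?_, ?_⟩ <;> linarith [f1.1, f1.2, f2.1, f2.2]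
  have hlen := le_sum_of_forall_mem_Ico (fun s => by simp only [hρ]; positivity) hcover
  refine hlen.trans ?_
  have hsumA : ∑ p, A p = ∑ b ∈ Finset.range T, S b ^ 2 :=
    Finset.sum_fiberwise (Finset.range T) l fun b => S b ^ 2
  have hS2 : ∑ b ∈ Finset.range T, S b ^ 2 ≤ k * (a ^ 2 * d ^ 6) := by
    calc ∑ b ∈ Finset.range T, S b ^ 2
        ≤ ∑ b ∈ Finset.range T, k * ∑ r ∈ Finset.range k, ‖defect d u (i + b * k + r)‖ ^ 2 := by
          refine Finset.sum_le_sum fun b _ => ?_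
          have := sq_sum_le_card_mul_sum_sq (s := Finset.range k)
            (f := fun r => ‖defect d u (i + b * k + r)‖)
          rwa [Finset.card_range] at this
      _ = k * ∑ r ∈ Finset.range (T * k), ‖defect d u (i + r)‖ ^ 2 := by
          rw [← Finset.mul_sum, sum_range_mul_eq fun r => ‖defect d u r‖ ^ 2]
      _ ≤ k * (a ^ 2 * d ^ 6) := by
          gcongr
          exact h.sum_shift_le (by omega)
  have hsqrt : ∑ p, √(A p) ≤ k * (a * d ^ 3) := by
    refine abs_le_of_sq_le_sq' ?_ (by positivity) |>.2
    have := sq_sum_le_card_mul_sum_sq (s := Finset.univ) (f := fun p => √(A p))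
    simp only [Real.sq_sqrt (hA0 _), Finset.card_univ, Fintype.card_fin, hsumA] at this
    calc _ ≤ _ := this
      _ ≤ k * (k * (a ^ 2 * d ^ 6)) := by gcongr
      _ = _ := by ring
  calc ∑ s, 2 * ρ s = 80 / d ^ 2 * ∑ p, √(A p) := by
        rw [Fintype.sum_prod_type, Finset.mul_sum]
        refine Finset.sum_congr rfl fun p _ => ?_
        simp only [hρ, Fintype.sum_bool]
        ring
    _ ≤ 80 / d ^ 2 * (k * (a * d ^ 3)) := by gcongr
    _ = 80 * (k * d) * a := by field_simp

theorem abs_norm_chir_sub_le (h : IsLowEnergyChain N q a d u) {s M x y : ℕ}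
    (hs : s + M + 1 ≤ N) (hxy : x ≤ y) (hsx : s ≤ x) (hyM : y < s + M) :
    |‖chir d u x‖ - ‖chir d u y‖|
      ≤ (∑ r ∈ Finset.range M, ‖defect d u (s + r)‖) / d ^ 2 := by
  have hd := h.d_pos
  rw [← Real.dist_eq]
  refine (dist_le_Ico_sum_dist (fun n => ‖chir d u n‖) hxy).trans ?_
  calc ∑ n ∈ Finset.Ico x y, dist ‖chir d u n‖ ‖chir d u (n + 1)‖
      ≤ ∑ n ∈ Finset.Ico x y, ‖defect d u n‖ / d ^ 2 := by
        refine Finset.sum_le_sum fun n hn => ?_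
        have := Finset.mem_Ico.1 hn
        rw [dist_comm, Real.dist_eq]
        exact (abs_norm_sub_norm_le _ _).trans
          (norm_chir_succ_sub_le hd (h.norm_eq_one _ (by omega)))
    _ ≤ ∑ n ∈ Finset.Ico s (s + M), ‖defect d u n‖ / d ^ 2 :=
        Finset.sum_le_sum_of_subset_of_nonneg (Finset.Ico_subset_Ico hsx hyM.le)
          fun n _ _ => by positivity
    _ = _ := by
        rw [Finset.sum_Ico_eq_sum_range, ← Finset.sum_div, Nat.add_sub_cancel_left]

theorem div_le_of_sq_le_mul {d M E₁ E₂ : ℝ} (h1 : d ^ 2 / 4 ≤ E₁)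
    (h2 : E₁ ^ 2 ≤ M * E₂) (hE2 : 0 ≤ E₂) (hM2 : M * d ^ 2 ≤ 2) : d ^ 6 / 256 ≤ E₂ := by
  have h3 : (d ^ 2 / 4) ^ 2 ≤ M * E₂ := le_trans (by gcongr) h2
  have h4 : d ^ 2 * (M * E₂) ≤ 2 * E₂ := by
    calc d ^ 2 * (M * E₂) = (M * d ^ 2) * E₂ := by ring
      _ ≤ 2 * E₂ := by gcongr
  have h5 : d ^ 2 * (d ^ 2 / 4) ^ 2 ≤ d ^ 2 * (M * E₂) :=
    mul_le_mul_of_nonneg_left h3 (sq_nonneg d)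
  have h6 : 0 ≤ d ^ 6 := by positivity
  linarith

/-- A window of length `M ≈ 1 / √δ` in which the angular velocity becomes short carries a fixed
amount of the energy: the angular velocity is either short on the whole window, or changes its
length within the window. -/
theorem le_sum_of_norm_chir_lt (h : IsLowEnergyChain N q a d u) {s M : ℕ} (hs : s + M + 1 ≤ N)
    (hM1 : 1 ≤ M * d ^ 2) (hM2 : M * d ^ 2 ≤ 2)
    (hz : ∃ m, s ≤ m ∧ m < s + M ∧ ‖chir d u m‖ < 1 / 2) :
    d ^ 6 / 256 ≤ ∑ r ∈ Finset.range M, ‖defect d u (s + r)‖ ^ 2 := by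
  have ha := h.a_nonneg
  have hd := h.d_pos
  obtain ⟨m, hsm, hmM, hm⟩ := hz
  by_cases hall : ∀ r < M, ‖chir d u (s + r)‖ ≤ 3 / 4
  · have h1 : ∀ r ∈ Finset.range M, d ^ 8 / 256 ≤ ‖defect d u (s + r)‖ ^ 2 := by
      intro r hr
      have hr := Finset.mem_range.1 hr
      have h2 := (abs_norm_chir_sub_one_le hd h.d_le_one h.mul_le_one
        (by linarith [h.add_le]) (u := u) (m := s + r) (h.norm_eq_one _ (by omega))
        (h.norm_eq_one _ (by omega)) (h.norm_eq_one _ (by omega))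
        (h.norm_defect_le (by omega))).1
      have h3 := (abs_le.1 h2).1
      have h4 := hall r hr
      have h5 := h.add_le
      have h6 : d ^ 4 / 16 ≤ ‖defect d u (s + r)‖ := by
        have : 1 / 16 ≤ ‖defect d u (s + r)‖ / d ^ 4 := by linarith
        rw [le_div_iff₀ (by positivity)] at this
        linarith
      calc d ^ 8 / 256 = (d ^ 4 / 16) ^ 2 := by ring
        _ ≤ _ := by gcongr
    refine le_trans ?_ (Finset.sum_le_sum h1)
    rw [Finset.sum_const, Finset.card_range, nsmul_eq_mul]
    have : 0 ≤ (M * d ^ 2 - 1) * d ^ 6 := mul_nonneg (by linarith) (by positivity)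
    linarith
  · push Not at hall
    obtain ⟨r, hr, hr2⟩ := hall
    have hvar := fun x y => h.abs_norm_chir_sub_le hs (x := x) (y := y)
    have h1 : 1 / 4 ≤ (∑ r ∈ Finset.range M, ‖defect d u (s + r)‖) / d ^ 2 := by
      have h2 : 1 / 4 ≤ |‖chir d u (s + r)‖ - ‖chir d u m‖| := by
        exact le_trans (by linarith) (le_abs_self _)
      rcases le_total (s + r) m with h3 | h3
      · exact h2.trans (hvar _ _ h3 (by omega) hmM)
      · rw [abs_sub_comm] at h2
        exact h2.trans (hvar _ _ h3 hsm (by omega))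
    have h2 := sq_sum_le_card_mul_sum_sq (s := Finset.range M)
      (f := fun r => ‖defect d u (s + r)‖)
    rw [Finset.card_range] at h2
    rw [le_div_iff₀ (by positivity)] at h1
    exact div_le_of_sq_le_mul (by linarith) h2 (Finset.sum_nonneg fun r _ => sq_nonneg _) hM2

open Classical in
theorem card_filter_norm_chir_lt_le (h : IsLowEnergyChain N q a d u) {W M : ℕ}
    (hW : W * M + 1 ≤ N) (hM1 : 1 ≤ M * d ^ 2) (hM2 : M * d ^ 2 ≤ 2) :
    (((Finset.range W).filter fun b =>
      ∃ m, b * M ≤ m ∧ m < b * M + M ∧ ‖chir d u m‖ < 1 / 2).card : ℝ) ≤ 256 * a ^ 2 := by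
  have hd := h.d_pos
  set B := (Finset.range W).filter fun b =>
      ∃ m, b * M ≤ m ∧ m < b * M + M ∧ ‖chir d u m‖ < 1 / 2
  have h1 : ∑ b ∈ B, d ^ 6 / 256 ≤ a ^ 2 * d ^ 6 :=
    calc ∑ b ∈ B, d ^ 6 / 256
        ≤ ∑ b ∈ B, ∑ r ∈ Finset.range M, ‖defect d u (b * M + r)‖ ^ 2 := by
          refine Finset.sum_le_sum fun b hb => ?_
          obtain ⟨hbW, hbz⟩ := Finset.mem_filter.1 hb
          have hb1 : (b + 1) * M ≤ W * M :=
            Nat.mul_le_mul_right M (Finset.mem_range.1 hbW)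
          rw [Nat.succ_mul] at hb1
          exact h.le_sum_of_norm_chir_lt (by omega) hM1 hM2 hbz
      _ ≤ ∑ b ∈ Finset.range W, ∑ r ∈ Finset.range M, ‖defect d u (b * M + r)‖ ^ 2 :=
          Finset.sum_le_sum_of_subset_of_nonneg (Finset.filter_subset _ _)
            fun b _ _ => Finset.sum_nonneg fun r _ => sq_nonneg _
      _ = ∑ r ∈ Finset.range (W * M), ‖defect d u (0 + r)‖ ^ 2 := by
          rw [← sum_range_mul_eq fun r => ‖defect d u r‖ ^ 2]
          simp only [zero_add]
      _ ≤ a ^ 2 * d ^ 6 := h.sum_shift_le (by omega)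
  rw [Finset.sum_const, nsmul_eq_mul] at h1
  refine le_of_mul_le_mul_right ?_ (by positivity : 0 < d ^ 6)
  linarith

theorem abs_norm_chir_pred_sub_one_le (h : IsLowEnergyChain N q a d u) (hN : 2 ≤ N) :
    |‖chir d u (N - 1)‖ - 1| ≤ 2 * (a / d) + (2 * d ^ 4 + a * d ^ 3) := by
  have hd := h.d_pos
  obtain ⟨n, rfl⟩ : ∃ n, N = n + 2 := ⟨N - 2, by omega⟩
  have he := h.norm_defect_le (m := n) le_rfl
  have := (abs_norm_chir_sub_one_le hd h.d_le_one h.mul_le_one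
        (by linarith [h.add_le]) (u := u) (m := n) (h.norm_eq_one _ (by omega))
        (h.norm_eq_one _ (by omega)) (h.norm_eq_one _ (by omega)) he).2
  refine this.trans ?_
  have : ‖defect d u n‖ / d ^ 4 ≤ a / d := by
    calc _ ≤ a * d ^ 3 / d ^ 4 := by gcongr
      _ = a / d := by field_simp
  linarith

theorem sum_abs_norm_chir_sub_one_le (h : IsLowEnergyChain N q a d u) :
    ∑ m ∈ Finset.range (N - 1), |‖chir d u m‖ - 1|
      ≤ 2 * (√N * a / d) + N * (2 * d ^ 4 + a * d ^ 3) := by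
  have ha := h.a_nonneg
  have hd := h.d_pos
  have hN : ((N - 1 : ℕ) : ℝ) ≤ N := by exact_mod_cast Nat.sub_le N 1
  have h1 : ∑ m ∈ Finset.range (N - 1), ‖defect d u m‖ ≤ √N * (a * d ^ 3) := by
    refine abs_le_of_sq_le_sq' ?_ (by positivity) |>.2
    refine sq_sum_le_card_mul_sum_sq.trans ?_
    rw [Finset.card_range, mul_pow, Real.sq_sqrt (by positivity)]
    calc _ ≤ (N : ℝ) * (a ^ 2 * d ^ 6) := by
          gcongr
          exact h.sum_le
      _ = _ := by ring
  calc ∑ m ∈ Finset.range (N - 1), |‖chir d u m‖ - 1|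
      ≤ ∑ m ∈ Finset.range (N - 1),
          (2 * (‖defect d u m‖ / d ^ 4) + (2 * d ^ 4 + a * d ^ 3)) := by
        refine Finset.sum_le_sum fun m hm => ?_
        have hm := Finset.mem_range.1 hm
        exact (abs_norm_chir_sub_one_le hd h.d_le_one h.mul_le_one
          (by linarith [h.add_le]) (u := u) (m := m) (h.norm_eq_one _ (by omega))
          (h.norm_eq_one _ (by omega)) (h.norm_eq_one _ (by omega))
          (h.norm_defect_le (by omega))).1
    _ = 2 * ((∑ m ∈ Finset.range (N - 1), ‖defect d u m‖) / d ^ 4)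
          + (N - 1 : ℕ) * (2 * d ^ 4 + a * d ^ 3) := by
        rw [Finset.sum_add_distrib, ← Finset.mul_sum, ← Finset.sum_div, Finset.sum_const,
          Finset.card_range, nsmul_eq_mul]
    _ ≤ 2 * (√N * (a * d ^ 3) / d ^ 4) + N * (2 * d ^ 4 + a * d ^ 3) := by gcongr
    _ = _ := by
        congr 2
        field_simp

end IsLowEnergyChain

/-! ### Compactness for functions oscillating only near finitely many points -/

theorem eventually_notMem_Icc_of_tendsto {K : ℕ} {p : ℕ → Fin K → ℝ} {P : Fin K → ℝ}
    {ε : ℕ → ℝ} (hp : Tendsto p atTop (𝓝 P)) (hε : Tendsto ε atTop (𝓝 0)) {α β : ℝ} (hβ : β < 1)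
    (hP : ∀ r, P r ∉ Icc α β) :
    ∀ᶠ j in atTop, β ≤ 1 - ε j ∧ ∀ r, p j r ∉ Icc (α - ε j) (β + ε j) := by
  refine Eventually.and ?_ (eventually_all.2 fun r => ?_)
  · have : Tendsto (fun j => 1 - ε j) atTop (𝓝 (1 - 0)) := hε.const_sub 1
    exact (this.eventually (lt_mem_nhds (by simpa using hβ))).mono fun j hj => hj.le
  · have hr : Tendsto (fun j => p j r) atTop (𝓝 (P r)) := (tendsto_pi_nhds.1 hp) r
    by_cases h : α ≤ P r
    · have h2 : β < P r := lt_of_not_ge fun h3 => hP r ⟨h, h3⟩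
      have := (hr.sub hε).eventually (lt_mem_nhds (by simpa using h2))
      filter_upwards [this] with j hj hj2
      linarith [hj2.2]
    · have := (hr.add hε).eventually (gt_mem_nhds (by simpa using not_le.1 h))
      filter_upwards [this] with j hj hj2
      linarith [hj2.1]

theorem notMem_of_mem_Ioo_orderEmbOfFin {S : Finset ℝ} {m : ℕ} (h : S.card = m + 1) {i : Fin m}
    {x : ℝ} (hx : x ∈ Ioo (S.orderEmbOfFin h i.castSucc) (S.orderEmbOfFin h i.succ)) :
    x ∉ S := by
  intro hxS
  have : x ∈ range (S.orderEmbOfFin h) := by rw [Finset.range_orderEmbOfFin]; exact hxS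
  obtain ⟨j, rfl⟩ := this
  have h1 := (S.orderEmbOfFin h).lt_iff_lt.1 hx.1
  have h2 := (S.orderEmbOfFin h).lt_iff_lt.1 hx.2
  rw [Fin.lt_def] at h1 h2
  simp only [Fin.val_castSucc, Fin.val_succ] at h1 h2
  omega

/-- Bounded functions on the unit interval whose oscillation vanishes away from at most `K` points
have a subsequence converging pointwise to a piecewise constant function, off finitely many
points. The jump points of the limit are the limits of the exceptional points. -/
theorem exists_subseq_tendsto_piecewise {K : ℕ} {p : ℕ → Fin K → ℝ}
    (hp : ∀ n r, p n r ∈ Icc (0 : ℝ) 1) {ε ω : ℕ → ℝ} (hε : Tendsto ε atTop (𝓝 0))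
    (hω : Tendsto ω atTop (𝓝 0)) {ν : ℕ → ℝ → E3} (hν : ∀ n x, ‖ν n x‖ ≤ 1)
    (hosc : ∀ᶠ n in atTop, ∀ x y, 0 ≤ x → x ≤ y → y ≤ 1 - ε n →
      (∀ r, p n r ∉ Icc (x - ε n) (y + ε n)) → ‖ν n x - ν n y‖ ≤ ω n) :
    ∃ φ : ℕ → ℕ, StrictMono φ ∧ ∃ (m : ℕ) (t : Fin (m + 1) → ℝ) (c : Fin m → E3),
      StrictMono t ∧ t 0 = 0 ∧ t (Fin.last m) = 1 ∧
      ∀ i : Fin m, ∀ x ∈ Ioo (t i.castSucc) (t i.succ),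
        Tendsto (fun j => ν (φ j) x) atTop (𝓝 (c i)) ∧
        ∀ᶠ j in atTop, x ≤ 1 - ε (φ j) ∧
          ∀ r, p (φ j) r ∉ Icc (x - ε (φ j)) (x + ε (φ j)) := by
  obtain ⟨P, hP, φ, hφ, hpφ⟩ := (isCompact_univ_pi fun _ : Fin K => isCompact_Icc
    (a := (0 : ℝ)) (b := 1)).tendsto_subseq (x := p) fun n => mem_univ_pi.2 fun r => hp n r
  have hP' := mem_univ_pi.1 hP
  set S : Finset ℝ := insert 0 (insert 1 (Finset.univ.image P)) with hS
  have hS01 : ∀ x ∈ S, x ∈ Icc (0 : ℝ) 1 := by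
    intro x hx
    simp only [hS, Finset.mem_insert, Finset.mem_image, Finset.mem_univ, true_and] at hx
    rcases hx with rfl | rfl | ⟨r, rfl⟩
    · simp
    · simp
    · exact hP' r
  have h0S : (0 : ℝ) ∈ S := by simp [hS]
  have h1S : (1 : ℝ) ∈ S := by simp [hS]
  obtain ⟨m, hm⟩ : ∃ m, S.card = m + 1 :=
    ⟨S.card - 1, by have := Finset.card_pos.2 ⟨0, h0S⟩; omega⟩
  set t := S.orderEmbOfFin hm with ht
  have htS : ∀ i, t i ∈ S := fun i => Finset.orderEmbOfFin_mem _ _ i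
  have hmem : ∀ x ∈ S, ∃ i, t i = x := fun x hx => by
    have : x ∈ range t := by rw [ht, Finset.range_orderEmbOfFin]; exact hx
    exact this
  have ht0 : t 0 = 0 := by
    obtain ⟨i, hi⟩ := hmem 0 h0S
    refine le_antisymm ?_ (hS01 _ (htS 0)).1
    rw [← hi]; exact t.monotone (Fin.zero_le i)
  have ht1 : t (Fin.last m) = 1 := by
    obtain ⟨i, hi⟩ := hmem 1 h1S
    refine le_antisymm (hS01 _ (htS _)).2 ?_
    rw [← hi]; exact t.monotone (Fin.le_last i)
  -- Convergence at the midpoints suffices, since the oscillation vanishes between the jumps.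
  set μ : Fin m → ℝ := fun i => (t i.castSucc + t i.succ) / 2 with hμ
  have hlt : ∀ i : Fin m, t i.castSucc < t i.succ := fun i => t.strictMono i.castSucc_lt_succ
  have hμmem : ∀ i, μ i ∈ Ioo (t i.castSucc) (t i.succ) := fun i => by
    have := hlt i
    constructor <;> simp only [hμ] <;> linarith
  obtain ⟨c, -, ψ, hψ, hc⟩ := (isCompact_univ_pi fun _ : Fin m =>
    isCompact_closedBall (0 : E3) 1).tendsto_subseq (x := fun n i => ν (φ n) (μ i))
    fun n => mem_univ_pi.2 fun i => by simpa using hν (φ n) (μ i)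
  have hχ : StrictMono (φ ∘ ψ) := hφ.comp hψ
  refine ⟨φ ∘ ψ, hχ, m, t, c, t.strictMono, ht0, ht1, fun i x hx => ?_⟩
  have haway : ∀ α β, t i.castSucc < α → β < t i.succ →
      ∀ᶠ j in atTop, β ≤ 1 - ε ((φ ∘ ψ) j) ∧
        ∀ r, p ((φ ∘ ψ) j) r ∉ Icc (α - ε ((φ ∘ ψ) j)) (β + ε ((φ ∘ ψ) j)) := by
    intro α β hα hβ
    refine eventually_notMem_Icc_of_tendsto (p := fun j => p ((φ ∘ ψ) j))
      (ε := fun j => ε ((φ ∘ ψ) j)) (hpφ.comp hψ.tendsto_atTop) (hε.comp hχ.tendsto_atTop)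
      (hβ.trans_le (hS01 _ (htS _)).2) fun r hr => ?_
    exact notMem_of_mem_Ioo_orderEmbOfFin hm (i := i) (x := P r)
      ⟨hα.trans_le hr.1, hr.2.trans_lt hβ⟩ (by simp [hS])
  refine ⟨?_, haway x x hx.1 hx.2⟩
  have hci : Tendsto (fun j => ν ((φ ∘ ψ) j) (μ i)) atTop (𝓝 (c i)) := tendsto_pi_nhds.1 hc i
  have h0 : 0 ≤ t i.castSucc := (hS01 _ (htS _)).1
  have hosc' := hχ.tendsto_atTop.eventually hosc
  have hbound : ∀ᶠ j in atTop,
      dist (ν ((φ ∘ ψ) j) (μ i)) (ν ((φ ∘ ψ) j) x) ≤ ω ((φ ∘ ψ) j) := by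
    rcases le_total x (μ i) with h | h
    · filter_upwards [hosc', haway x (μ i) hx.1 (hμmem i).2] with j h1 h2
      rw [dist_comm, dist_eq_norm]
      exact h1 _ _ (h0.trans hx.1.le) h h2.1 h2.2
    · filter_upwards [hosc', haway (μ i) x (hμmem i).1 hx.2] with j h1 h2
      rw [dist_eq_norm]
      exact h1 _ _ (h0.trans (hμmem i).1.le) h h2.1 h2.2
  refine (tendsto_iff_of_dist ?_).1 hci
  exact squeeze_zero' (Eventually.of_forall fun j => dist_nonneg) hbound
    (hω.comp hχ.tendsto_atTop)

theorem tendsto_cross {f g : ℕ → E3} {a b : E3} (hf : Tendsto f atTop (𝓝 a))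
    (hg : Tendsto g atTop (𝓝 b)) : Tendsto (fun j => cross (f j) (g j)) atTop (𝓝 (cross a b)) := by
  have h := (continuous_cross.tendsto (a, b)).comp (hf.prodMk_nhds hg)
  exact h

/-- A limit of unit vectors asymptotically parallel to elements of `E n` belongs, up to the sign,
to the Kuratowski limit of the sets `E n`. -/
theorem KuratowskiTendsto.mem_union_neg_of_tendsto {E : ℕ → Set E3} {F : Set E3}
    (h : KuratowskiTendsto E F) (hE : ∀ n, (E n).Nonempty) (hE1 : ∀ n, ∀ x ∈ E n, ‖x‖ = 1)
    {φ : ℕ → ℕ} (hφ : StrictMono φ) {w : ℕ → E3} {c : E3} {η : ℕ → ℝ}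
    (hw : Tendsto w atTop (𝓝 c)) (hη : Tendsto η atTop (𝓝 0))
    (hev : ∀ᶠ j in atTop, ‖w j‖ = 1 ∧ ∃ x ∈ E (φ j), ‖cross x (w j)‖ ≤ η j) :
    c ∈ F ∪ -F := by
  have hc1 : ‖c‖ = 1 :=
    tendsto_nhds_unique hw.norm (tendsto_const_nhds.congr' (hev.mono fun j hj => hj.1.symm))
  have hex : ∀ j, ∃ y ∈ E (φ j), (∃ x ∈ E (φ j), ‖cross x (w j)‖ ≤ η j) →
      ‖cross y (w j)‖ ≤ η j := by
    intro j
    by_cases hj : ∃ x ∈ E (φ j), ‖cross x (w j)‖ ≤ η j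
    · obtain ⟨x, hx, hx2⟩ := hj
      exact ⟨x, hx, fun _ => hx2⟩
    · obtain ⟨x, hx⟩ := hE (φ j)
      exact ⟨x, hx, fun h => absurd h hj⟩
  choose y hyE hy using hex
  obtain ⟨Y, hY, ψ, hψ, hyY⟩ := (isCompact_sphere (0 : E3) 1).tendsto_subseq (x := y)
    fun j => by simpa using hE1 _ _ (hyE j)
  have hY1 : ‖Y‖ = 1 := by simpa using hY
  have hYF : Y ∈ F := by
    choose x₀ hx₀ using hE
    refine h.2.1 (Function.extend φ y x₀) (fun n => ?_) Y ?_
    · by_cases hn : ∃ j, φ j = n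
      · obtain ⟨j, rfl⟩ := hn
        rw [hφ.injective.extend_apply]; exact hyE j
      · rw [Function.extend_apply' _ _ _ hn]; exact hx₀ n
    · refine MapClusterPt.of_comp (φ := φ ∘ ψ) (p := atTop) (hφ.comp hψ).tendsto_atTop ?_
      refine Tendsto.mapClusterPt (hyY.congr fun j => ?_)
      exact (hφ.injective.extend_apply y x₀ (ψ j)).symm
  have hcr : cross Y c = 0 := by
    have h1 : Tendsto (fun j => cross (y (ψ j)) (w (ψ j))) atTop (𝓝 (cross Y c)) :=
      tendsto_cross hyY (hw.comp hψ.tendsto_atTop)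
    have h2 : Tendsto (fun j => cross (y (ψ j)) (w (ψ j))) atTop (𝓝 0) :=
      squeeze_zero_norm' ((hψ.tendsto_atTop.eventually hev).mono fun j hj => hy _ hj.2)
        (hη.comp hψ.tendsto_atTop)
    exact tendsto_nhds_unique h1 h2
  rcases eq_or_eq_neg_of_cross_eq_zero hY1 hc1 hcr with rfl | rfl
  · exact Or.inl hYF
  · exact Or.inr (by simpa using hYF)

/-! ### Step functions -/

/-- The step function with value `c i` on the interval `(t i, t (i+1))`. -/
noncomputable def stepFun {m : ℕ} (t : Fin (m + 1) → ℝ) (c : Fin m → E3) (x : ℝ) : E3 :=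
  ∑ i : Fin m, (Ioo (t i.castSucc) (t i.succ)).indicator (fun _ => c i) x

theorem stepFun_apply {m : ℕ} {t : Fin (m + 1) → ℝ} (ht : StrictMono t) (c : Fin m → E3)
    {i : Fin m} {x : ℝ} (hx : x ∈ Ioo (t i.castSucc) (t i.succ)) : stepFun t c x = c i := by
  have hlt : ∀ i j : Fin m, x ∈ Ioo (t i.castSucc) (t i.succ) →
      x ∈ Ioo (t j.castSucc) (t j.succ) → i ≤ j := by
    intro i j hi hj
    have h := ht.lt_iff_lt.1 (hi.1.trans hj.2)
    rw [Fin.lt_def] at h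
    simp only [Fin.val_castSucc, Fin.val_succ] at h
    rw [Fin.le_def]; omega
  rw [stepFun, Finset.sum_eq_single i]
  · rw [indicator_of_mem hx]
  · intro j _ hji
    exact indicator_of_notMem (fun hj => hji (le_antisymm (hlt j i hj hx) (hlt i j hx hj))) _
  · simp

theorem memLp_stepFun {m : ℕ} (t : Fin (m + 1) → ℝ) (c : Fin m → E3) :
    MemLp (stepFun t c) 1 volI :=
  memLp_finsetSum Finset.univ fun i _ => (memLp_const (c i)).indicator measurableSet_Ioo

theorem exists_mem_Ioo_of_notMem_range {m : ℕ} {t : Fin (m + 1) → ℝ} (h0 : t 0 = 0)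
    (h1 : t (Fin.last m) = 1) {x : ℝ} (hx : x ∈ Icc (0 : ℝ) 1) (hxt : x ∉ range t) :
    ∃ i : Fin m, x ∈ Ioo (t i.castSucc) (t i.succ) := by
  have hne : ∀ i, t i ≠ x := fun i hi => hxt ⟨i, hi⟩
  by_contra! hcon
  have hall : ∀ i : Fin (m + 1), t i < x := by
    intro i
    induction i using Fin.induction with
    | zero => exact lt_of_le_of_ne (h0 ▸ hx.1) (hne 0)
    | succ i ih =>
      refine lt_of_le_of_ne (not_lt.1 fun h => hcon i ⟨ih, h⟩) (hne _)
  have := hall (Fin.last m)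
  rw [h1] at this
  exact absurd hx.2 (not_le.2 this)

theorem ae_exists_mem_Ioo {m : ℕ} {t : Fin (m + 1) → ℝ} (h0 : t 0 = 0)
    (h1 : t (Fin.last m) = 1) :
    ∀ᵐ x ∂volI, ∃ i : Fin m, x ∈ Ioo (t i.castSucc) (t i.succ) := by
  rw [ae_restrict_iff' measurableSet_Icc]
  have : ∀ᵐ x : ℝ, x ∉ range t := (finite_range t).countable.ae_notMem volume
  filter_upwards [this] with x hxt hx
  exact exists_mem_Ioo_of_notMem_range h0 h1 hx hxt

/-! ### From spin configurations to chains of low energy -/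

theorem exists_config_of_constrainedEnergy_lt {lam δ : ℝ} {Q : Set E3} {z : L1I} {c : ℝ}
    (h : constrainedEnergy lam δ Q z < ENNReal.ofReal c) :
    ∃ v, IsConfig lam (circles Q) v ∧ chirality lam δ v = z ∧ slicedEnergy lam δ v < c := by
  rw [constrainedEnergy] at h
  obtain ⟨v, hv⟩ := iInf_lt_iff.1 h
  obtain ⟨⟨hv1, hv2⟩, hv3⟩ := iInf_lt_iff.1 hv
  exact ⟨v, hv1, hv2, ENNReal.lt_ofReal_iff_toReal_lt (by simp) |>.1 hv3 |>.trans_le' (by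
    rw [ENNReal.toReal_ofReal']; exact le_max_left _ _)⟩

theorem natCast_mem_latticePoints {lam : ℝ} {m : ℕ} (hlam : 0 < lam) (hm : m ≤ ⌊1 / lam⌋₊) :
    (m : ℤ) ∈ latticePoints lam := by
  rw [latticePoints, Finset.mem_Icc, ← Int.natCast_floor_eq_floor (by positivity)]
  exact ⟨by positivity, by exact_mod_cast hm⟩

theorem sum_range_le_slicedEnergy {lam d : ℝ} (hlam : 0 < lam) (v : ℤ → E3) :
    lam / 2 * ∑ m ∈ Finset.range (⌊1 / lam⌋₊ - 1), ‖defect d (fun m : ℕ => v m) m‖ ^ 2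
      ≤ slicedEnergy lam (d ^ 4) v := by
  set F : ℤ → ℝ := fun i => ‖v i - (2 * (1 - d ^ 4)) • v (i + 1) + v (i + 2)‖ ^ 2 with hF
  have h1 : ∑ m ∈ Finset.range (⌊1 / lam⌋₊ - 1), ‖defect d (fun m : ℕ => v m) m‖ ^ 2
      = ∑ i ∈ (Finset.range (⌊1 / lam⌋₊ - 1)).map Nat.castEmbedding, F i := by
    rw [Finset.sum_map]
    refine Finset.sum_congr rfl fun m _ => ?_
    simp [hF, defect]
  have h2 : ∑ i ∈ (Finset.range (⌊1 / lam⌋₊ - 1)).map Nat.castEmbedding, F i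
      ≤ ∑ i ∈ interiorPoints lam, F i := by
    refine Finset.sum_le_sum_of_subset_of_nonneg ?_ fun _ _ _ => sq_nonneg _
    intro i hi
    obtain ⟨m, hm, rfl⟩ := Finset.mem_map.1 hi
    have hm := Finset.mem_range.1 hm
    refine Finset.mem_filter.2 ⟨natCast_mem_latticePoints hlam (by omega), ?_⟩
    exact natCast_mem_latticePoints (m := m + 2) hlam (by omega)
  have h3 : slicedEnergy lam (d ^ 4) v = lam / 2 * ∑ i ∈ interiorPoints lam, F i := by
    rw [slicedEnergy, ← Finset.mul_sum]; ring
  rw [h3, h1]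
  gcongr

theorem isLowEnergyChain_of_isConfig {lam a d : ℝ} {k : ℕ} {q : Fin k → E3} {v : ℤ → E3}
    (hlam : 0 < lam) (ha : 0 ≤ a) (hd : 0 < d) (hd1 : d ≤ 1) (hq : ∀ l, ‖q l‖ = 1)
    (hv : IsConfig lam (circles (range q)) v)
    (hE : slicedEnergy lam (d ^ 4) v ≤ lam / 2 * (a ^ 2 * d ^ 6)) (h1 : a * d ≤ 1)
    (h2 : 2 * d ^ 4 + a * d ^ 3 ≤ 1 / 8)
    (h3 : (k : ℝ) ^ 2 * (4 * d ^ 4 + 2 * a * d ^ 3) ≤ 1) :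
    IsLowEnergyChain ⌊1 / lam⌋₊ q a d (fun m : ℕ => v m) where
  a_nonneg := ha
  d_pos := hd
  d_le_one := hd1
  norm_normal := hq
  norm_eq_one m hm := (hv.1 m (natCast_mem_latticePoints hlam hm)).1
  mem_circle m hm := by
    obtain ⟨-, _, ⟨l, rfl⟩, hl⟩ := hv.1 m (natCast_mem_latticePoints hlam hm)
    exact ⟨l, hl⟩
  sum_le := le_of_mul_le_mul_left ((sum_range_le_slicedEnergy hlam v).trans hE) (by positivity)
  mul_le_one := h1
  add_le := h2
  sq_mul_le := h3

theorem interpolation_chiralityAt {lam d : ℝ} (hlam : 0 < lam) (v : ℤ → E3) {x : ℝ} (hx : 0 ≤ x)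
    (hN : 1 ≤ ⌊1 / lam⌋₊) :
    interpolation lam (chiralityAt lam (d ^ 4) v) x
      = chir d (fun m : ℕ => v m) (min ⌊x / lam⌋₊ (⌊1 / lam⌋₊ - 1)) := by
  have e : min ⌊x / lam⌋ (⌊1 / lam⌋ - 1) = ((min ⌊x / lam⌋₊ (⌊1 / lam⌋₊ - 1) : ℕ) : ℤ) := by
    rw [← Int.natCast_floor_eq_floor (by positivity : 0 ≤ x / lam),
      ← Int.natCast_floor_eq_floor (by positivity : 0 ≤ 1 / lam)]
    push_cast [hN]
    rfl
  rw [interpolation, chiralityAt, e, chir]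
  push_cast
  rfl

/-- A bounded number of points such that the angular velocity is not too short away from them. They
are the left ends of the windows in which the angular velocity becomes short. -/
theorem IsLowEnergyChain.exists_points {lam a d : ℝ} {k : ℕ} {q : Fin k → E3} {u : ℕ → E3}
    (hlam : 0 < lam) (h : IsLowEnergyChain ⌊1 / lam⌋₊ q a d u) :
    ∃ p : Fin ⌊256 * a ^ 2⌋₊ → ℝ, (∀ r, p r ∈ Icc (0 : ℝ) 1) ∧
      ∀ x y, 0 ≤ x → x ≤ y → y ≤ 1 - lam * (2 / d ^ 2 + k + 3) →
        (∀ r, p r ∉ Icc (x - lam * (2 / d ^ 2 + k + 3)) (y + lam * (2 / d ^ 2 + k + 3))) →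
        ∀ m, ⌊x / lam⌋₊ ≤ m → m ≤ ⌊y / lam⌋₊ →
          m + k + 1 ≤ ⌊1 / lam⌋₊ ∧ 1 / 2 ≤ ‖chir d u m‖ := by
  classical
  have hd := h.d_pos
  set N := ⌊1 / lam⌋₊ with hN
  set M := ⌈(d ^ 2)⁻¹⌉₊ with hM
  have hd2 : 0 < d ^ 2 := by positivity
  have hd21 : d ^ 2 ≤ 1 := pow_le_one₀ hd.le h.d_le_one
  have hM1 : 1 ≤ M * d ^ 2 := by
    calc (1 : ℝ) = (d ^ 2)⁻¹ * d ^ 2 := by field_simp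
      _ ≤ M * d ^ 2 := by gcongr; exact Nat.le_ceil _
  have hM2 : M * d ^ 2 ≤ 2 := by
    have : (M : ℝ) < (d ^ 2)⁻¹ + 1 := Nat.ceil_lt_add_one (by positivity)
    calc M * d ^ 2 ≤ ((d ^ 2)⁻¹ + 1) * d ^ 2 := by gcongr
      _ = 1 + d ^ 2 := by field_simp
      _ ≤ 2 := by linarith
  have hM3 : (M : ℝ) ≤ 2 / d ^ 2 := by rwa [le_div_iff₀ hd2]
  have hM0 : 0 < M := Nat.ceil_pos.2 (by positivity)
  have hNlam : lam * N ≤ 1 := by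
    have := Nat.floor_le (by positivity : 0 ≤ 1 / lam)
    rw [← hN, le_div_iff₀ hlam] at this
    linarith
  have hNlam2 : 1 < lam * (N + 1) := by
    have := Nat.lt_floor_add_one (1 / lam)
    rw [← hN, div_lt_iff₀ hlam] at this
    linarith
  set W := (N - 1) / M with hW
  set B := (Finset.range W).filter fun b =>
    ∃ m, b * M ≤ m ∧ m < b * M + M ∧ ‖chir d u m‖ < 1 / 2 with hB
  have hWM : W * M ≤ N - 1 := Nat.div_mul_le_self _ _
  have hcard : B.card ≤ ⌊256 * a ^ 2⌋₊ := by
    rcases Nat.eq_zero_or_pos N with hN0 | hN0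
    · have : W = 0 := by rw [hW, hN0]; simp
      simp [hB, this]
    · exact Nat.le_floor (h.card_filter_norm_chir_lt_le (W := W) (M := M) (by omega) hM1 hM2)
  -- Surplus indices `r` are sent to the harmless point `0`.
  refine ⟨fun r => if hr : (r : ℕ) < B.card then lam * (M * (B.equivFin.symm ⟨r, hr⟩ : ℕ)) else 0,
    fun r => ?_, ?_⟩
  · by_cases hr : (r : ℕ) < B.card
    · simp only [hr, dif_pos]
      have hbB := (B.equivFin.symm ⟨r, hr⟩).2
      set b : ℕ := (B.equivFin.symm ⟨r, hr⟩ : ℕ)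
      have hbW := Finset.mem_range.1 (Finset.mem_filter.1 hbB).1
      refine ⟨by positivity, le_trans ?_ hNlam⟩
      gcongr
      have : b * M ≤ W * M := Nat.mul_le_mul_right M hbW.le
      have : M * b ≤ N := by rw [mul_comm]; omega
      exact_mod_cast this
    · simp [hr]
  · intro x y hx hxy hy hp m hxm hmy
    have hmy' : lam * m ≤ y := by
      have := (Nat.le_floor_iff (div_nonneg (hx.trans hxy) hlam.le)).1 hmy
      rw [le_div_iff₀ hlam] at this
      linarith
    have hxm' : x ≤ lam * (m + 1) := by
      have h1 := Nat.lt_floor_add_one (x / lam)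
      have h2 : ((⌊x / lam⌋₊ : ℕ) : ℝ) ≤ m := by exact_mod_cast hxm
      have h3 : x / lam < m + 1 := by linarith
      rw [div_lt_iff₀ hlam] at h3
      linarith
    have hMlam : lam * M ≤ lam * (2 / d ^ 2) := by gcongr
    have hk0 : 0 ≤ lam * k := by positivity
    -- As `y` stays away from `1`, the window and the block starting near `m` fit into the chain.
    have hroom : m + M + k + 2 ≤ N := by
      have h1 : lam * (m + M + k + 2) < lam * (N + 1) := by
        linarith
      have h2 := lt_of_mul_lt_mul_left h1 hlam.le
      have h3 : m + M + k + 2 < N + 1 := by exact_mod_cast h2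
      omega
    refine ⟨by omega, ?_⟩
    by_contra! hlt
    set b := m / M with hb
    have hb1 : b * M ≤ m := Nat.div_mul_le_self _ _
    have hb2 : m < b * M + M := by
      have := Nat.lt_div_mul_add (a := m) hM0
      exact this
    have hbW : b < W := by
      rw [hW, Nat.lt_iff_add_one_le, Nat.le_div_iff_mul_le hM0, Nat.succ_mul]
      omega
    have hbB : b ∈ B := Finset.mem_filter.2 ⟨Finset.mem_range.2 hbW, m, hb1, hb2, hlt⟩
    set r := B.equivFin ⟨b, hbB⟩ with hr
    refine hp ⟨r, r.2.trans_le hcard⟩ ?_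
    have e : ((B.equivFin.symm ⟨(r : ℕ), r.2⟩ : B) : ℕ) = b := by
      rw [Fin.eta, hr, Equiv.symm_apply_apply]
    simp only [r.2, dif_pos, e]
    have hb1' : lam * (M * b) ≤ lam * m := by
      gcongr
      rw [mul_comm]
      exact_mod_cast hb1
    have hb2' : lam * m ≤ lam * (M * b + M) := by
      gcongr
      rw [mul_comm]
      exact_mod_cast hb2.le
    have hnn : 0 ≤ lam * (2 / d ^ 2) := by positivity
    constructor <;> linarith

theorem lintegral_comp_floor_le {lam : ℝ} (hlam : 0 < lam) {G : ℕ → ℝ} (hG : ∀ m, 0 ≤ G m) :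
    ∫⁻ x, ENNReal.ofReal (G ⌊x / lam⌋₊) ∂volI
      ≤ ENNReal.ofReal (lam * ∑ m ∈ Finset.range (⌊1 / lam⌋₊ + 1), G m) := by
  set I : ℕ → Set ℝ := fun m => Ico (lam * m) (lam * (m + 1)) with hI
  calc ∫⁻ x, ENNReal.ofReal (G ⌊x / lam⌋₊) ∂volI
      ≤ ∫⁻ x, ∑ m ∈ Finset.range (⌊1 / lam⌋₊ + 1),
          (I m).indicator (fun _ => ENNReal.ofReal (G m)) x ∂volI := by
        refine setLIntegral_mono' measurableSet_Icc fun x hx => ?_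
        have hx0 : 0 ≤ x / lam := div_nonneg hx.1 hlam.le
        have hmem : ⌊x / lam⌋₊ ∈ Finset.range (⌊1 / lam⌋₊ + 1) :=
          Finset.mem_range.2 (Nat.lt_succ_of_le (Nat.floor_mono (by gcongr; exact hx.2)))
        have hxI : x ∈ I ⌊x / lam⌋₊ := by
          have h1 := Nat.floor_le hx0
          have h2 := Nat.lt_floor_add_one (x / lam)
          rw [le_div_iff₀ hlam] at h1
          rw [div_lt_iff₀ hlam] at h2
          constructor <;> linarith
        refine le_trans ?_ (Finset.single_le_sum
          (f := fun m => (I m).indicator (fun _ => ENNReal.ofReal (G m)) x)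
          (fun _ _ => zero_le) hmem)
        simp only [indicator_of_mem hxI, le_refl]
    _ ≤ ∫⁻ x, ∑ m ∈ Finset.range (⌊1 / lam⌋₊ + 1),
          (I m).indicator (fun _ => ENNReal.ofReal (G m)) x ∂volume :=
        lintegral_mono' Measure.restrict_le_self le_rfl
    _ = ∑ m ∈ Finset.range (⌊1 / lam⌋₊ + 1), ENNReal.ofReal (lam * G m) := by
        rw [lintegral_finsetSum _ fun m _ => measurable_const.indicator measurableSet_Ico]
        refine Finset.sum_congr rfl fun m _ => ?_
        rw [lintegral_indicator_const measurableSet_Ico, Real.volume_Ico,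
          ← ENNReal.ofReal_mul (hG m)]
        congr 1; ring
    _ = ENNReal.ofReal (lam * ∑ m ∈ Finset.range (⌊1 / lam⌋₊ + 1), G m) := by
        rw [← ENNReal.ofReal_sum_of_nonneg fun m _ => mul_nonneg hlam.le (hG m), Finset.mul_sum]

/-- The angular velocities have nearly unit length in the mean. -/
theorem IsLowEnergyChain.lintegral_abs_norm_sub_one_le {lam a d : ℝ} {k : ℕ} {q : Fin k → E3}
    {u : ℕ → E3} (hlam : 0 < lam) (h : IsLowEnergyChain ⌊1 / lam⌋₊ q a d u)
    (hN : 2 ≤ ⌊1 / lam⌋₊) :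
    ∫⁻ x, ENNReal.ofReal |‖chir d u (min ⌊x / lam⌋₊ (⌊1 / lam⌋₊ - 1))‖ - 1| ∂volI
      ≤ ENNReal.ofReal (6 * a * √(lam / d ^ 2) + 3 * (2 * d ^ 4 + a * d ^ 3)) := by
  have ha := h.a_nonneg
  have hd := h.d_pos
  refine (lintegral_comp_floor_le hlam
    (G := fun m => |‖chir d u (min m (⌊1 / lam⌋₊ - 1))‖ - 1|) fun m => abs_nonneg _).trans ?_
  refine ENNReal.ofReal_le_ofReal ?_
  have h1 := h.sum_abs_norm_chir_sub_one_le
  have h2 := h.abs_norm_chir_pred_sub_one_le hN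
  have hNlam : ⌊1 / lam⌋₊ * lam ≤ 1 := by
    have := Nat.floor_le (by positivity : 0 ≤ 1 / lam)
    rwa [le_div_iff₀ hlam] at this
  set N := ⌊1 / lam⌋₊
  set ζ := 2 * d ^ 4 + a * d ^ 3
  have hζ : 0 ≤ ζ := by positivity
  have hN1 : (1 : ℝ) ≤ N := by exact_mod_cast (by omega : 1 ≤ N)
  have hsN : 1 ≤ √(N : ℝ) := Real.one_le_sqrt.2 hN1
  obtain ⟨n, hn⟩ : ∃ n, N = n + 1 := ⟨N - 1, by omega⟩
  -- The value at `N - 1` is taken twice, on the last full cell and on the remainder up to `1`.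
  have h3 : ∑ m ∈ Finset.range (N + 1), |‖chir d u (min m (N - 1))‖ - 1|
      = ∑ m ∈ Finset.range (N - 1), |‖chir d u m‖ - 1| + 2 * |‖chir d u (N - 1)‖ - 1| := by
    rw [hn, Finset.sum_range_succ, Finset.sum_range_succ, Nat.add_sub_cancel]
    have : ∑ m ∈ Finset.range n, |‖chir d u (min m n)‖ - 1|
        = ∑ m ∈ Finset.range n, |‖chir d u m‖ - 1| :=
      Finset.sum_congr rfl fun m hm => by rw [min_eq_left (Finset.mem_range.1 hm).le]
    rw [this, min_self, min_eq_right n.le_succ]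
    ring
  rw [h3]
  have h4 : a / d ≤ √N * a / d := by
    rw [mul_div_assoc]
    exact le_mul_of_one_le_left (by positivity) hsN
  have h5 : ζ ≤ N * ζ := le_mul_of_one_le_left hζ hN1
  have h6 : lam * √N ≤ √lam := by
    have : lam = √lam * √lam := (Real.mul_self_sqrt hlam.le).symm
    calc lam * √N = √lam * (√N * √lam) := by nth_rw 1 [this]; ring
      _ = √lam * √(N * lam) := by rw [Real.sqrt_mul (by positivity)]
      _ ≤ √lam * 1 := by gcongr; exact Real.sqrt_le_one.2 hNlam
      _ = √lam := mul_one _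
  have h7 : √(lam / d ^ 2) = √lam / d := by rw [Real.sqrt_div hlam.le, Real.sqrt_sq hd.le]
  calc lam * (∑ m ∈ Finset.range (N - 1), |‖chir d u m‖ - 1| + 2 * |‖chir d u (N - 1)‖ - 1|)
      ≤ lam * (6 * (√N * a / d) + 3 * (N * ζ)) := by
        refine mul_le_mul_of_nonneg_left ?_ hlam.le
        linarith
    _ = 6 * a * ((lam * √N) / d) + 3 * ((N * lam) * ζ) := by ring
    _ ≤ 6 * a * (√lam / d) + 3 * (1 * ζ) := by gcongr
    _ = _ := by rw [h7, one_mul]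

/-! ### Compactness of the chiralities -/

theorem aemeasurable_normalize {α : Type*} [MeasurableSpace α] {μ : Measure α} {f : α → E3}
    (hf : AEMeasurable f μ) : AEMeasurable (fun x => NormedSpace.normalize (f x)) μ :=
  hf.norm.inv.smul hf

/-- Pointwise convergence of the directions and convergence in the mean of the lengths to `1` give
convergence in `L¹`. -/
theorem tendsto_eLpNorm_sub_of_normalize {f : ℕ → ℝ → E3} {g : ℝ → E3}
    (hf : ∀ n, AEMeasurable (f n) volI) (hg : AEMeasurable g volI)
    (hlen : Tendsto (fun n => ∫⁻ x, ENNReal.ofReal |‖f n x‖ - 1| ∂volI) atTop (𝓝 0))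
    (hdir : ∀ᵐ x ∂volI, Tendsto (fun n => NormedSpace.normalize (f n x)) atTop (𝓝 (g x))) :
    Tendsto (fun n => eLpNorm (f n - g) 1 volI) atTop (𝓝 0) := by
  have hν := fun n => aemeasurable_normalize (hf n)
  have hmeas : ∀ n, AEMeasurable (fun x => ‖NormedSpace.normalize (f n x) - g x‖ₑ) volI :=
    fun n => ((hν n).sub hg).enorm
  have hdct : Tendsto (fun n => ∫⁻ x, ‖NormedSpace.normalize (f n x) - g x‖ₑ ∂volI) atTop
      (𝓝 0) := by
    have := tendsto_lintegral_of_dominated_convergence' (μ := volI)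
      (F := fun n x => ‖NormedSpace.normalize (f n x) - g x‖ₑ) (f := fun _ => 0)
      (fun _ => ENNReal.ofReal 2) hmeas (fun n => ?_) ?_ ?_
    · simpa using this
    · filter_upwards [hdir] with x hx
      have hg1 : ‖g x‖ ≤ 1 :=
        le_of_tendsto hx.norm (Eventually.of_forall fun n => norm_normalize_le_one _)
      rw [← ofReal_norm]
      refine ENNReal.ofReal_le_ofReal ((norm_sub_le _ _).trans ?_)
      linarith [norm_normalize_le_one (f n x)]
    · rw [lintegral_const]
      exact ENNReal.mul_ne_top ENNReal.ofReal_ne_top (measure_ne_top _ _)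
    · filter_upwards [hdir] with x hx
      have h1 := (hx.sub_const (g x)).enorm
      simpa using h1
  refine tendsto_of_tendsto_of_tendsto_of_le_of_le tendsto_const_nhds
    (by simpa using hlen.add hdct) (fun _ => zero_le) fun n => ?_
  rw [eLpNorm_one_eq_lintegral_enorm]
  simp only
  rw [← lintegral_add_right' _ (hmeas n)]
  refine lintegral_mono fun x => ?_
  have e : (f n - g) x = (f n x - NormedSpace.normalize (f n x))
      + (NormedSpace.normalize (f n x) - g x) := by
    rw [Pi.sub_apply]; abel
  rw [e]
  refine (enorm_add_le _ _).trans (add_le_add ?_ le_rfl)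
  rw [← ofReal_norm]
  exact ENNReal.ofReal_le_ofReal (norm_sub_normalize_le _)

/-- Compactness for chains of low energy. -/
theorem exists_subseq_tendsto_chirality {lam d : ℕ → ℝ} {a : ℝ} {k : ℕ → ℕ}
    {q : ∀ n, Fin (k n) → E3} {v : ℕ → ℤ → E3} {Qbar : Set E3} (hlam : ∀ n, 0 < lam n)
    (hd : ∀ n, 0 < d n) (hlam0 : Tendsto lam atTop (𝓝 0)) (hd0 : Tendsto d atTop (𝓝 0))
    (hlamd : Tendsto (fun n => lam n / d n ^ 2) atTop (𝓝 0))
    (hkd : Tendsto (fun n => k n * d n) atTop (𝓝 0)) (hk : ∀ n, 0 < k n)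
    (hq : ∀ n l, ‖q n l‖ = 1) (hQ : KuratowskiTendsto (fun n => range (q n)) Qbar)
    (hv : ∀ᶠ n in atTop,
      IsLowEnergyChain ⌊1 / lam n⌋₊ (q n) a (d n) (fun m : ℕ => v n m)) :
    ∃ (φ : ℕ → ℕ) (zlim : L1I), StrictMono φ ∧ IsBVpc (Qbar ∪ -Qbar) zlim ∧
      Tendsto (fun j => chirality (lam (φ j)) (d (φ j) ^ 4) (v (φ j))) atTop (𝓝 zlim) := by
  set Z : ℕ → ℝ → E3 := fun n => interpolation (lam n) (chiralityAt (lam n) (d n ^ 4) (v n))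
  set ε : ℕ → ℝ := fun n => lam n * (2 / d n ^ 2 + k n + 3) with hεdef
  set ω : ℕ → ℝ := fun n => 80 * (k n * d n) * a with hωdef
  have hε : Tendsto ε atTop (𝓝 0) := by
    have h1 : Tendsto (fun n => 2 * (lam n / d n ^ 2) + (lam n / d n ^ 2) * (k n * d n) * d n
        + lam n * 3) atTop (𝓝 (2 * 0 + 0 * 0 * 0 + 0 * 3)) :=
      ((hlamd.const_mul 2).add ((hlamd.mul hkd).mul hd0)).add (hlam0.mul_const 3)
    norm_num at h1
    refine h1.congr fun n => ?_
    have := (hd n).ne'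
    simp only [hεdef]
    field_simp
  have hω : Tendsto ω atTop (𝓝 0) := by
    simpa using (hkd.const_mul 80).mul_const a
  have hN : ∀ᶠ n in atTop, 2 ≤ ⌊1 / lam n⌋₊ := by
    filter_upwards [hlam0.eventually (gt_mem_nhds (by norm_num : (0 : ℝ) < 1 / 2))] with n hn
    refine Nat.le_floor ?_
    rw [le_div_iff₀ (hlam n)]
    push_cast
    linarith
  have hpts : ∀ n, ∃ p : Fin ⌊256 * a ^ 2⌋₊ → ℝ, (∀ r, p r ∈ Icc (0 : ℝ) 1) ∧
      (IsLowEnergyChain ⌊1 / lam n⌋₊ (q n) a (d n) (fun m : ℕ => v n m) →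
        ∀ x y, 0 ≤ x → x ≤ y → y ≤ 1 - ε n → (∀ r, p r ∉ Icc (x - ε n) (y + ε n)) →
        ∀ m, ⌊x / lam n⌋₊ ≤ m → m ≤ ⌊y / lam n⌋₊ →
          m + k n + 1 ≤ ⌊1 / lam n⌋₊ ∧ 1 / 2 ≤ ‖chir (d n) (fun m : ℕ => v n m) m‖) := by
    intro n
    by_cases h : IsLowEnergyChain ⌊1 / lam n⌋₊ (q n) a (d n) (fun m : ℕ => v n m)
    · obtain ⟨p, hp1, hp2⟩ := h.exists_points (hlam n)
      exact ⟨p, hp1, fun _ => hp2⟩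
    · exact ⟨fun _ => 0, by simp, fun h' => absurd h' h⟩
  choose p hp01 hp using hpts
  have hZ : ∀ n, 2 ≤ ⌊1 / lam n⌋₊ → ∀ x, 0 ≤ x → ⌊x / lam n⌋₊ + k n + 1 ≤ ⌊1 / lam n⌋₊ →
      Z n x = chir (d n) (fun m : ℕ => v n m) ⌊x / lam n⌋₊ := by
    intro n hn x hx hx2
    rw [← min_eq_left (by omega : ⌊x / lam n⌋₊ ≤ ⌊1 / lam n⌋₊ - 1)]
    exact interpolation_chiralityAt (hlam n) (v n) hx (by omega)
  obtain ⟨φ, hφ, m, t, c, ht, ht0, ht1, hlim⟩ := exists_subseq_tendsto_piecewise hp01 hε hω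
    (ν := fun n x => NormedSpace.normalize (Z n x)) (fun n x => norm_normalize_le_one _) (by
      filter_upwards [hv, hN] with n hvn hn x y hx hxy hy hxyp
      have hfl : ⌊x / lam n⌋₊ ≤ ⌊y / lam n⌋₊ :=
        Nat.floor_mono (div_le_div_of_nonneg_right hxy (hlam n).le)
      have h1 := hp n hvn x y hx hxy hy hxyp
      rw [hZ n hn x hx (h1 _ le_rfl hfl).1, hZ n hn y (hx.trans hxy) (h1 _ hfl le_rfl).1]
      exact hvn.norm_normalize_chir_sub_le hfl (h1 _ hfl le_rfl).1
        fun m h2 h3 => (h1 m h2 h3).2)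
  have hcQ : ∀ i, c i ∈ Qbar ∪ -Qbar := by
    intro i
    have hlt : t i.castSucc < t i.succ := ht i.castSucc_lt_succ
    have ht0' : 0 ≤ t i.castSucc := ht0 ▸ ht.monotone (Fin.zero_le _)
    obtain ⟨x, hx⟩ := exists_between hlt
    obtain ⟨hx1, hx2⟩ := hlim i x hx
    have hη : Tendsto (fun j => 8 * (k (φ j) * d (φ j)) * a) atTop (𝓝 0) := by
      have : Tendsto (fun n => 8 * (k n * d n) * a) atTop (𝓝 0) := by
        simpa using (hkd.const_mul 8).mul_const a
      exact this.comp hφ.tendsto_atTop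
    refine hQ.mem_union_neg_of_tendsto (fun n => ⟨q n ⟨0, hk n⟩, mem_range_self _⟩) ?_ hφ hx1 hη ?_
    · rintro n _ ⟨l, rfl⟩
      exact hq n l
    · filter_upwards [hφ.tendsto_atTop.eventually hv, hφ.tendsto_atTop.eventually hN, hx2]
        with j hvj hNj hxj
      have hx0 : 0 ≤ x := ht0'.trans hx.1.le
      obtain ⟨h1, h2⟩ := hp (φ j) hvj x x hx0 le_rfl hxj.1 hxj.2 _ le_rfl le_rfl
      rw [hZ (φ j) hNj x hx0 h1]
      refine ⟨NormedSpace.norm_normalize_eq_one_iff.2 (norm_pos_iff.1 (by linarith)), ?_⟩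
      obtain ⟨l, hl⟩ := hvj.exists_norm_cross_normalize_le h1 h2
      exact ⟨_, mem_range_self l, hl⟩
  have hlen : Tendsto (fun n => ∫⁻ x, ENNReal.ofReal |‖Z n x‖ - 1| ∂volI) atTop (𝓝 0) := by
    have hR : Tendsto (fun n => 6 * a * √(lam n / d n ^ 2) + 3 * (2 * d n ^ 4 + a * d n ^ 3))
        atTop (𝓝 (6 * a * √0 + 3 * (2 * 0 ^ 4 + a * 0 ^ 3))) :=
      ((hlamd.sqrt).const_mul _).add
        ((((hd0.pow 4).const_mul 2).add ((hd0.pow 3).const_mul a)).const_mul 3)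
    have hR' := ENNReal.tendsto_ofReal hR
    norm_num at hR'
    refine tendsto_of_tendsto_of_tendsto_of_le_of_le' tendsto_const_nhds hR'
      (Eventually.of_forall fun _ => zero_le) ?_
    filter_upwards [hv, hN] with n hvn hn
    refine le_trans (le_of_eq ?_) (hvn.lintegral_abs_norm_sub_one_le (hlam n) hn)
    refine setLIntegral_congr_fun measurableSet_Icc fun x hx => ?_
    simp only [Z]
    rw [interpolation_chiralityAt (hlam n) (v n) hx.1 (by omega)]
  have hZm := fun n => memLp_interpolation (lam n) (chiralityAt (lam n) (d n ^ 4) (v n))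
  have hconv : Tendsto (fun j => eLpNorm (Z (φ j) - stepFun t c) 1 volI) atTop (𝓝 0) := by
    refine tendsto_eLpNorm_sub_of_normalize (fun j => (hZm (φ j)).aestronglyMeasurable.aemeasurable)
      (memLp_stepFun t c).aestronglyMeasurable.aemeasurable (hlen.comp hφ.tendsto_atTop) ?_
    filter_upwards [ae_exists_mem_Ioo ht0 ht1] with x ⟨i, hi⟩
    rw [stepFun_apply ht c hi]
    exact (hlim i x hi).1
  refine ⟨φ, (memLp_stepFun t c).toLp _, hφ, ⟨m, t, c, ht, ht0, ht1, hcQ, fun i => ?_⟩, ?_⟩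
  · have hsub : Ioo (t i.castSucc) (t i.succ) ⊆ Icc 0 1 := fun x hx =>
      ⟨(ht0 ▸ ht.monotone (Fin.zero_le _) : 0 ≤ t i.castSucc).trans hx.1.le,
        hx.2.le.trans (ht1 ▸ ht.monotone (Fin.le_last _))⟩
    have h1 := ae_mono (Measure.restrict_mono hsub le_rfl) (memLp_stepFun t c).coeFn_toLp
    filter_upwards [h1, ae_restrict_mem measurableSet_Ioo] with x hx hxi
    rw [hx, stepFun_apply ht c hxi]
  · exact (Lp.tendsto_Lp_iff_tendsto_eLpNorm'' _ (fun j => hZm (φ j)) _ (memLp_stepFun t c)).2 hconv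

end HelicalXY

theorem mainTheorem2
    (lam δ : ℕ → ℝ) (hlam : ∀ n, 0 < lam n) (hδ : ∀ n, 0 < δ n)
    (hlam0 : Tendsto lam atTop (𝓝 0)) (hδ0 : Tendsto δ atTop (𝓝 0))
    (hlamδ : Tendsto (fun n => lam n / Real.sqrt (δ n)) atTop (𝓝 0))
    (k : ℕ → ℕ)
    (hk : Tendsto (fun n => (k n : ℝ) * δ n ^ (1 / 4 : ℝ)) atTop (𝓝 0))
    (q : ∀ n, Fin (k n) → E3) (hq_inj : ∀ n, Function.Injective (q n))
    (hq : ∀ n l, ‖q n l‖ = 1)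
    (Qbar : Set E3) (hQ : KuratowskiTendsto (fun n => range (q n)) Qbar)
    (u : ℕ → ℤ → E3) (hu : ∀ n, IsConfig (lam n) (circles (range (q n))) (u n))
    (z : ℕ → L1I) (hz : ∀ n, z n = chirality (lam n) (δ n) (u n))
    (C : ℝ) (hC : 0 < C)
    (hE : ∀ n, constrainedEnergy (lam n) (δ n) (range (q n)) (z n)
      ≤ ENNReal.ofReal (C * lam n * δ n ^ (3 / 2 : ℝ))) :
    ∃ (φ : ℕ → ℕ) (zlim : L1I), StrictMono φ ∧
      IsBVpc (Qbar ∪ -Qbar) zlim ∧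
      Tendsto (fun j => z (φ j)) atTop (𝓝 zlim) := by
  set d : ℕ → ℝ := fun n => δ n ^ (1 / 4 : ℝ) with hd_def
  have hd : ∀ n, 0 < d n := fun n => Real.rpow_pos_of_pos (hδ n) _
  have hd4 : ∀ n, d n ^ 4 = δ n := fun n => by
    rw [hd_def, ← Real.rpow_natCast, ← Real.rpow_mul (hδ n).le]; norm_num
  have hd6 : ∀ n, δ n ^ (3 / 2 : ℝ) = d n ^ 6 := fun n => by
    rw [hd_def, ← Real.rpow_natCast, ← Real.rpow_mul (hδ n).le]; norm_num
  have hd2 : ∀ n, Real.sqrt (δ n) = d n ^ 2 := fun n => by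
    rw [← hd4 n, show d n ^ 4 = (d n ^ 2) ^ 2 by ring, Real.sqrt_sq (sq_nonneg _)]
  have hd0 : Tendsto d atTop (𝓝 0) := by
    have := hδ0.rpow_const (p := 1 / 4) (Or.inr (by norm_num))
    rwa [Real.zero_rpow (by norm_num)] at this
  have hkd : Tendsto (fun n => (k n : ℝ) * d n) atTop (𝓝 0) := hk
  simp only [hd2] at hlamδ
  -- The energy of `u n` itself may exceed the infimum over its chirality class, so `u n`
  -- is replaced by an almost optimal `v n`.
  have hex : ∀ n, ∃ v, IsConfig (lam n) (circles (range (q n))) v ∧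
      chirality (lam n) (δ n) v = z n ∧
      slicedEnergy (lam n) (δ n) v < 2 * (C * lam n * δ n ^ (3 / 2 : ℝ)) := fun n => by
    have hpos : 0 < C * lam n * δ n ^ (3 / 2 : ℝ) :=
      mul_pos (mul_pos hC (hlam n)) (Real.rpow_pos_of_pos (hδ n) _)
    exact exists_config_of_constrainedEnergy_lt ((hE n).trans_lt
      ((ENNReal.ofReal_lt_ofReal_iff (by positivity)).2 (by linarith)))
  choose v hv hvz hvE using hex
  set a := Real.sqrt (4 * C)
  have ha2 : a ^ 2 = 4 * C := Real.sq_sqrt (by positivity)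
  have hsmall1 : ∀ᶠ n in atTop, a * d n ≤ 1 := by
    have : Tendsto (fun n => a * d n) atTop (𝓝 0) := by simpa using hd0.const_mul a
    exact (this.eventually (gt_mem_nhds one_pos)).mono fun n hn => hn.le
  have hsmall2 : ∀ᶠ n in atTop, 2 * d n ^ 4 + a * d n ^ 3 ≤ 1 / 8 := by
    have : Tendsto (fun n => 2 * d n ^ 4 + a * d n ^ 3) atTop (𝓝 0) := by
      simpa using ((hd0.pow 4).const_mul 2).add ((hd0.pow 3).const_mul a)
    exact (this.eventually (gt_mem_nhds (by norm_num : (0 : ℝ) < 1 / 8))).mono fun n hn => hn.le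
  have hsmall3 : ∀ᶠ n in atTop, (k n : ℝ) ^ 2 * (4 * d n ^ 4 + 2 * a * d n ^ 3) ≤ 1 := by
    have : Tendsto (fun n => (k n * d n) ^ 2 * (4 * d n ^ 2 + 2 * a * d n)) atTop (𝓝 0) := by
      simpa using (hkd.pow 2).mul (((hd0.pow 2).const_mul 4).add (hd0.const_mul (2 * a)))
    refine (this.eventually (gt_mem_nhds one_pos)).mono fun n hn => ?_
    linarith
  have hchain : ∀ᶠ n in atTop,
      IsLowEnergyChain ⌊1 / lam n⌋₊ (q n) a (d n) (fun m : ℕ => v n m) := by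
    filter_upwards [hsmall1, hsmall2, hsmall3, hd0.eventually (gt_mem_nhds one_pos)]
      with n h1 h2 h3 h4
    refine isLowEnergyChain_of_isConfig (hlam n) (Real.sqrt_nonneg _) (hd n) h4.le (hq n) (hv n)
      ?_ h1 h2 h3
    rw [hd4, ha2, ← hd6]
    linarith [hvE n]
  have hkpos : ∀ n, 0 < k n := fun n => by
    obtain ⟨-, _, ⟨l, -⟩, -⟩ := (hu n).1 0 (natCast_mem_latticePoints (m := 0) (hlam n) (by simp))
    exact l.pos
  obtain ⟨φ, zlim, hφ, hz1, hz2⟩ := exists_subseq_tendsto_chirality hlam hd hlam0 hd0 hlamδ hkd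
    hkpos hq hQ hchain
  refine ⟨φ, zlim, hφ, hz1, hz2.congr fun j => ?_⟩
  rw [hd4, hvz]
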